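/- All dg-rings are $\mathbb Z$-graded associative unital rings with a differential $d$ of degree $1$, $d^2=0$ and $d(ab)=d(a)b+(-1)^{|a|}a\,d(b)$; dg-modules are left dg-modules, and morphisms of dg-modules are linear, of degree $0$, and commute with the differentials. A dg-ring is called graded commutative if $ab=(-1)^{|a||b|}ba$ for homogeneous $a,b$, acyclic if its homology vanishes, and a dg-division ring if its only dg-left ideals and its only dg-right ideals are $0$ and the whole ring. Let $(K,d_K)$ be a graded commutative acyclic dg-division ring, let $(A,d_A)$ be a dg-algebra over $(K,d_K)$ through a homomorphism of dg-rings $\varphi:K\to A$ (so that $\varphi(K)$ lies in the graded centre of $A$), and suppose that $\varphi$ is dg-separable, i.e. the multiplication map $A\otimes_KA\to A$ is split as a morphism of dg-$A$-$A$-bimodules. Let $(L,d_L)$ be a graded commutative dg-division ring together with a homomorphism of dg-rings $K\to L$. For a set $I$ and a degree function $e:I\to\mathbb Z$ let $(A\otimes_KL)^{(I,e)}$ be the free dg-module over $A\otimes_KL$ with a basis $(\epsilon_i)_{i\in I}$ of cycles $\epsilon_i$ of degree $e(i)$, i.e. the direct sum over $i\in I$ of copies of $A\otimes_KL$ shifted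 so that the generators have degrees $e(i)$. Then every dg-module $(M,\delta)$ over $(A\otimes_KL,d_{A\otimes_KL})$ is, as a dg-module, a direct summand of $(A\otimes_KL)^{(I,e)}$ for some index set $I$ and some $e:I\to\mathbb Z$. More precisely: 1. If $(L,d_L)$ is acyclic, then $\ker(\delta)$ has a $\ker(d_L)$-basis of homogeneous elements, and for every such basis $I$ the dg-module $M$ is a direct summand of $(A\otimes_KL)^{(I,e)}$, where $e(i)$ is the degree of the basis element $i$. 2. If $d_L=0$ (since $K$ is acyclic this forces $L=0$), then $M$ has an $L$-basis of homogeneous elements, and for every such basis $I$ the dg-module $M$ is a direct summand of $(A\otimes_KL)^{(I,e)}$, where $e(i)$ is the degree of the basis element $i$. -/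

import Mathlib

universe u v w x y

open scoped TensorProduct DirectSum

noncomputable section

set_option linter.unusedSectionVars false

namespace DG

/-- The Koszul sign `(-1)^n`, as an integer. -/
def sgn (n : ℤ) : ℤ := (n.negOnePow : ℤ)

theorem sgn_add (m n : ℤ) : sgn (m + n) = sgn m * sgn n := by
  simp [sgn, Int.negOnePow_add]

theorem sgn_sq (m : ℤ) : sgn m * sgn m = 1 := by
  rw [← sgn_add, ← two_mul]; simp [sgn]

theorem sgn_one : sgn 1 = -1 := by simp [sgn]

theorem sgn_zero : sgn 0 = 1 := by simp [sgn]

/-! ### Differential graded rings -/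

/-- A differential graded ring: a `ℤ`-graded associative unital ring with a differential `d` of
degree `1` such that `d² = 0` and `d(ab) = d(a)b + (-1)^{|a|} a d(b)` for homogeneous `a`. -/
class DGRing (A : Type u) [Ring A] where
  deg : ℤ → Submodule ℤ A
  gradedAlgebra : GradedAlgebra deg
  d : A →+ A
  d_mem : ∀ {i : ℤ} {a : A}, a ∈ deg i → d a ∈ deg (i + 1)
  d_d : ∀ a : A, d (d a) = 0
  leibniz : ∀ {i : ℤ} {a : A}, a ∈ deg i → ∀ b : A, d (a * b) = d a * b + sgn i • (a * d b)

attribute [reducible, instance] DGRing.gradedAlgebra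

/-- The homogeneous components of a dg-ring. -/
abbrev gr (A : Type u) [Ring A] [DGRing A] : ℤ → Submodule ℤ A := DGRing.deg

/-- The differential of a dg-ring. -/
abbrev dif (A : Type u) [Ring A] [DGRing A] : A →+ A := DGRing.d

/-- A homomorphism of dg-rings (unital, of degree `0`, commuting with the differentials), that is,
a dg-extension `A → B`. -/
structure DGHom (A : Type u) (B : Type v) [Ring A] [DGRing A] [Ring B] [DGRing B]
    extends A →+* B where
  map_deg : ∀ {i : ℤ} {a : A}, a ∈ gr A i → toRingHom a ∈ gr B i
  map_d : ∀ a : A, toRingHom (dif A a) = dif B (toRingHom a)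

instance {A : Type u} {B : Type v} [Ring A] [DGRing A] [Ring B] [DGRing B] :
    CoeFun (DGHom A B) (fun _ => A → B) := ⟨fun f => f.toRingHom⟩

/-- The homology of the dg-ring vanishes: every cycle is a boundary. -/
def IsAcyclic (A : Type u) [Ring A] [DGRing A] : Prop :=
  ∀ a : A, dif A a = 0 → ∃ b : A, dif A b = a

/-- Graded commutativity: `ab = (-1)^{|a||b|} ba` for homogeneous `a`, `b`. -/
class IsGradedCommutative (A : Type u) [Ring A] [DGRing A] : Prop where
  comm : ∀ {i j : ℤ} {a b : A}, a ∈ gr A i → b ∈ gr A j → a * b = sgn (i * j) • (b * a)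

/-- The image of `φ : K → A` lies in the graded centre of `A`, that is, `φ` turns `A` into a
dg-algebra over the (graded commutative) dg-ring `K`. -/
class DGHom.IsGradedCentral {K : Type u} {A : Type v} [Ring K] [DGRing K] [Ring A] [DGRing A]
    (φ : DGHom K A) : Prop where
  comm : ∀ {i j : ℤ} {k : K} {a : A}, k ∈ gr K i → a ∈ gr A j →
    φ k * a = sgn (i * j) • (a * φ k)

instance {K : Type u} {L : Type v} [Ring K] [DGRing K] [Ring L] [DGRing L]
    [IsGradedCommutative L] (ψ : DGHom K L) : ψ.IsGradedCentral where
  comm hk ha := IsGradedCommutative.comm (ψ.map_deg hk) ha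

/-- An additive subgroup that is graded (contains the homogeneous components of its elements) and
stable under the differential. -/
def IsDGSubgroup {A : Type u} [Ring A] [DGRing A] (S : AddSubgroup A) : Prop :=
  (∀ s ∈ S, ∀ n : ℤ, (DirectSum.decompose (gr A) s n : A) ∈ S) ∧ ∀ s ∈ S, dif A s ∈ S

/-- Dg-left ideals. -/
def IsDGLeftIdeal {A : Type u} [Ring A] [DGRing A] (S : AddSubgroup A) : Prop :=
  IsDGSubgroup S ∧ ∀ a : A, ∀ s ∈ S, a * s ∈ S

/-- Dg-right ideals. -/
def IsDGRightIdeal {A : Type u} [Ring A] [DGRing A] (S : AddSubgroup A) : Prop :=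
  IsDGSubgroup S ∧ ∀ a : A, ∀ s ∈ S, s * a ∈ S

/-- Dg-division rings: the only dg-left ideals are `0` and `A`, and the only dg-right ideals are
`0` and `A`. -/
def IsDGDivision (A : Type u) [Ring A] [DGRing A] : Prop :=
  (∀ S : AddSubgroup A, IsDGLeftIdeal S → S = ⊥ ∨ S = ⊤) ∧
    ∀ S : AddSubgroup A, IsDGRightIdeal S → S = ⊥ ∨ S = ⊤

section Basic

variable {A : Type u} [Ring A] [DGRing A]

theorem one_mem_gr : (1 : A) ∈ gr A 0 := SetLike.GradedOne.one_mem

theorem mul_mem_gr {i j : ℤ} {a b : A} (ha : a ∈ gr A i) (hb : b ∈ gr A j) :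
    a * b ∈ gr A (i + j) := SetLike.GradedMul.mul_mem ha hb

theorem induction_gr {p : A → Prop} (h0 : p 0) (hh : ∀ i : ℤ, ∀ a ∈ gr A i, p a)
    (hadd : ∀ a b, p a → p b → p (a + b)) (a : A) : p a :=
  DirectSum.Decomposition.inductionOn (gr A) h0 (fun {i} m => hh i m m.2) hadd a

/-- The sign involution `a ↦ (-1)^{|a|} a`. -/
def signInv (A : Type u) [Ring A] [DGRing A] : A →+ A :=
  (DirectSum.toAddMonoid fun i : ℤ => (sgn i • (gr A i).subtype.toAddMonoidHom : gr A i →+ A)).comp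
    (DirectSum.decomposeAddEquiv (gr A)).toAddMonoidHom

theorem signInv_of_mem {i : ℤ} {a : A} (ha : a ∈ gr A i) : signInv A a = sgn i • a := by
  simp [signInv, DirectSum.decompose_of_mem _ ha]

theorem signInv_mem {i : ℤ} {a : A} (ha : a ∈ gr A i) : signInv A a ∈ gr A i := by
  rw [signInv_of_mem ha]; exact zsmul_mem ha _

theorem signInv_signInv (a : A) : signInv A (signInv A a) = a := by
  induction a using induction_gr with
  | h0 => simp
  | hh i a ha => rw [signInv_of_mem ha, map_zsmul, signInv_of_mem ha, smul_smul, sgn_sq, one_smul]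
  | hadd a b ha hb => simp [ha, hb]

theorem signInv_mul (a b : A) : signInv A (a * b) = signInv A a * signInv A b := by
  induction a using induction_gr with
  | h0 => simp
  | hadd a b ha hb => simp [ha, hb, add_mul]
  | hh i a ha =>
    induction b using induction_gr with
    | h0 => simp
    | hadd a b ha hb => simp [ha, hb, mul_add]
    | hh j b hb =>
      rw [signInv_of_mem ha, signInv_of_mem hb, signInv_of_mem (mul_mem_gr ha hb), sgn_add,
        smul_mul_smul_comm]

theorem d_mul (a b : A) : dif A (a * b) = dif A a * b + signInv A a * dif A b := by
  induction a using induction_gr with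
  | h0 => simp
  | hadd a b ha hb => simp [ha, hb, add_mul]; abel
  | hh i a ha => rw [DGRing.leibniz ha, signInv_of_mem ha, smul_mul_assoc]

theorem d_one : dif A 1 = 0 := by
  have h := d_mul (1 : A) 1
  rw [signInv_of_mem one_mem_gr, sgn_zero] at h
  simpa using h

theorem d_signInv (a : A) : dif A (signInv A a) = - signInv A (dif A a) := by
  induction a using induction_gr with
  | h0 => simp
  | hadd a b ha hb => simp [ha, hb]; abel
  | hh i a ha =>
    rw [signInv_of_mem ha, map_zsmul, signInv_of_mem (DGRing.d_mem ha), sgn_add, sgn_one]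
    simp

theorem map_signInv {B : Type v} [Ring B] [DGRing B] (φ : DGHom A B) (a : A) :
    φ (signInv A a) = signInv B (φ a) := by
  induction a using induction_gr with
  | h0 => simp
  | hadd a b ha hb => simp [ha, hb]
  | hh i a ha => rw [signInv_of_mem ha, map_zsmul, signInv_of_mem (φ.map_deg ha)]

/-- The subring `ker d` of cycles. -/
def cycles (A : Type u) [Ring A] [DGRing A] : Subring A where
  carrier := {a | dif A a = 0}
  zero_mem' := map_zero _
  one_mem' := d_one
  add_mem' ha hb := by
    simp only [Set.mem_ofPred_eq] at *
    rw [map_add, ha, hb, add_zero]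
  neg_mem' ha := by
    simp only [Set.mem_ofPred_eq] at *
    rw [map_neg, ha, neg_zero]
  mul_mem' ha hb := by
    simp only [Set.mem_ofPred_eq] at *
    rw [d_mul, ha, hb, zero_mul, mul_zero, add_zero]

end Basic

/-- A family of subobjects `N` of `X` is a direct sum decomposition as soon as there is an additive
map computing the components. -/
@[reducible] def decompositionOfComponents {X : Type u} {σ : Type v} [AddCommGroup X]
    [SetLike σ X] [AddSubgroupClass σ X] (N : ℤ → σ) (c : X →+ (ℤ →₀ X))
    (hmem : ∀ x n, c x n ∈ N n) (hsum : ∀ x, (c x).sum (fun _ y => y) = x)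
    (hc : ∀ n, ∀ x ∈ N n, c x = Finsupp.single n x) : DirectSum.Decomposition N :=
  DirectSum.IsInternal.chooseDecomposition N <| by
    classical
    constructor
    · rw [injective_iff_map_eq_zero]
      intro y hy
      have key : ∀ y : (⨁ n, N n), ∀ n, c (DirectSum.coeAddMonoidHom N y) n = (y n : X) := by
        intro y n
        induction y using DirectSum.induction_on with
        | zero => simp
        | add a b ha hb => simp [ha, hb]
        | of i a =>
          rw [DirectSum.coeAddMonoidHom_of, hc i a a.2, DirectSum.coe_of_apply,
            Finsupp.single_apply]
          split_ifs <;> rfl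
      ext n
      rw [← key y n, hy]
      simp
    · intro x
      refine ⟨∑ n ∈ (c x).support, DirectSum.of (fun n => N n) n ⟨c x n, hmem x n⟩, ?_⟩
      rw [map_sum]
      simp only [DirectSum.coeAddMonoidHom_of]
      exact hsum x

/-! ### The tensor product over a dg-ring -/

section Tensor

variable {K : Type u} {A : Type v} {L : Type w} [Ring K] [DGRing K] [Ring A] [DGRing A]
  [Ring L] [DGRing L]

/-- `A ⊗_ℤ L`, a ring with multiplication
`(a ⊗ l)(a' ⊗ l') = (-1)^{|l||a'|} aa' ⊗ ll'`. -/
abbrev PreTensor (A : Type v) (L : Type w) [Ring A] [DGRing A] [Ring L] [DGRing L] :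
    Type (max v w) := GradedTensorProduct ℤ (gr A) (gr L)

/-- The pure tensor `a ⊗ l` in `A ⊗_ℤ L`. -/
abbrev ptmul (a : A) (l : L) : PreTensor A L := GradedTensorProduct.tmul ℤ a l

/-- The subgroup of `A ⊗_ℤ L` generated by the elements `aφ(k) ⊗ l - a ⊗ ψ(k)l`. -/
def balanced (φ : DGHom K A) (ψ : DGHom K L) : AddSubgroup (PreTensor A L) :=
  AddSubgroup.closure {x | ∃ (a : A) (k : K) (l : L), x = ptmul (a * φ k) l - ptmul a (ψ k * l)}

/-- The tensor product `A ⊗_K L`. -/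
def Tensor (φ : DGHom K A) (ψ : DGHom K L) : Type (max v w) := PreTensor A L ⧸ balanced φ ψ

instance (φ : DGHom K A) (ψ : DGHom K L) : AddCommGroup (Tensor φ ψ) :=
  inferInstanceAs (AddCommGroup (PreTensor A L ⧸ balanced φ ψ))

/-- The projection `A ⊗_ℤ L → A ⊗_K L`. -/
def proj (φ : DGHom K A) (ψ : DGHom K L) : PreTensor A L →+ Tensor φ ψ :=
  QuotientAddGroup.mk' (balanced φ ψ)

/-- The pure tensor `a ⊗ l` in `A ⊗_K L`. -/
def tmul (φ : DGHom K A) (ψ : DGHom K L) (a : A) (l : L) : Tensor φ ψ := proj φ ψ (ptmul a l)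

theorem ptmul_add (a : A) (l l' : L) : ptmul a (l + l') = ptmul a l + ptmul a l' := by
  simp [ptmul, GradedTensorProduct.tmul, TensorProduct.tmul_add]

theorem add_ptmul (a a' : A) (l : L) : ptmul (a + a') l = ptmul a l + ptmul a' l := by
  simp [ptmul, GradedTensorProduct.tmul, TensorProduct.add_tmul]

theorem zero_ptmul (l : L) : ptmul (0 : A) l = 0 := by
  simp [ptmul, GradedTensorProduct.tmul]

theorem ptmul_zero (a : A) : ptmul a (0 : L) = 0 := by
  simp [ptmul, GradedTensorProduct.tmul]

theorem zsmul_ptmul (n : ℤ) (a : A) (l : L) : ptmul (n • a) l = n • ptmul a l := by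
  rw [ptmul, GradedTensorProduct.tmul, ← TensorProduct.smul_tmul', map_zsmul]

theorem ptmul_zsmul (n : ℤ) (a : A) (l : L) : ptmul a (n • l) = n • ptmul a l := by
  rw [ptmul, GradedTensorProduct.tmul, TensorProduct.tmul_smul, map_zsmul]

theorem ptmul_mul_ptmul {i j : ℤ} {l : L} {a' : A} (hl : l ∈ gr L i) (ha : a' ∈ gr A j)
    (a : A) (l' : L) :
    (ptmul a l : PreTensor A L) * ptmul a' l' = sgn (i * j) • ptmul (a * a') (l * l') := by
  have := GradedTensorProduct.tmul_coe_mul_coe_tmul (R := ℤ) (gr A) (gr L) a ⟨l, hl⟩ ⟨a', ha⟩ l'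
  rw [ptmul, ptmul, this, Units.smul_def]
  rfl

theorem preTensor_induction {p : PreTensor A L → Prop} (h0 : p 0)
    (hh : ∀ i j : ℤ, ∀ a ∈ gr A i, ∀ l ∈ gr L j, p (ptmul a l))
    (hadd : ∀ x y, p x → p y → p (x + y)) (x : PreTensor A L) : p x := by
  refine TensorProduct.induction_on (motive := p) x h0 (fun a l => ?_) hadd
  change p (ptmul a l)
  induction a using induction_gr with
  | h0 => rw [zero_ptmul]; exact h0
  | hadd a b ha hb => rw [add_ptmul]; exact hadd _ _ ha hb
  | hh i a ha =>
    induction l using induction_gr with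
    | h0 => rw [ptmul_zero]; exact h0
    | hadd a b ha hb => rw [ptmul_add]; exact hadd _ _ ha hb
    | hh j l hl => exact hh i j a ha l hl

variable (φ : DGHom K A) (ψ : DGHom K L)

theorem proj_surjective : Function.Surjective (proj φ ψ) := QuotientAddGroup.mk'_surjective _

theorem tensor_induction {p : Tensor φ ψ → Prop} (h0 : p 0)
    (hh : ∀ i j : ℤ, ∀ a ∈ gr A i, ∀ l ∈ gr L j, p (tmul φ ψ a l))
    (hadd : ∀ x y, p x → p y → p (x + y)) (x : Tensor φ ψ) : p x := by
  obtain ⟨x, rfl⟩ := proj_surjective φ ψ x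
  induction x using preTensor_induction with
  | h0 => rw [map_zero]; exact h0
  | hadd x y hx hy => rw [map_add]; exact hadd _ _ hx hy
  | hh i j a ha l hl => exact hh i j a ha l hl

theorem proj_eq_zero {x : PreTensor A L} : proj φ ψ x = 0 ↔ x ∈ balanced φ ψ :=
  QuotientAddGroup.eq_zero_iff x

theorem tmul_balance (a : A) (k : K) (l : L) : tmul φ ψ (a * φ k) l = tmul φ ψ a (ψ k * l) := by
  rw [tmul, tmul, ← sub_eq_zero, ← map_sub, proj_eq_zero]
  exact AddSubgroup.subset_closure ⟨a, k, l, rfl⟩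

/-- Additive maps out of `A ⊗_K L`. -/
def tlift {X : Type x} [AddCommGroup X] (f : PreTensor A L →+ X)
    (hf : ∀ a k l, f (ptmul (a * φ k) l) = f (ptmul a (ψ k * l))) : Tensor φ ψ →+ X :=
  QuotientAddGroup.lift (balanced φ ψ) f <| by
    rw [balanced, AddSubgroup.closure_le]
    rintro _ ⟨a, k, l, rfl⟩
    simp [hf]

@[simp] theorem tlift_proj {X : Type x} [AddCommGroup X] (f : PreTensor A L →+ X)
    (hf : ∀ a k l, f (ptmul (a * φ k) l) = f (ptmul a (ψ k * l))) (x : PreTensor A L) :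
    tlift φ ψ f hf (proj φ ψ x) = f x := rfl

@[simp] theorem tlift_tmul {X : Type x} [AddCommGroup X] (f : PreTensor A L →+ X)
    (hf : ∀ a k l, f (ptmul (a * φ k) l) = f (ptmul a (ψ k * l))) (a : A) (l : L) :
    tlift φ ψ f hf (tmul φ ψ a l) = f (ptmul a l) := rfl

/-- The map `f ⊗ g` on `A ⊗_ℤ L`. -/
def pmap {A' : Type*} {L' : Type*} [Ring A'] [DGRing A'] [Ring L'] [DGRing L'] (f : A →+ A')
    (g : L →+ L') : PreTensor A L →+ PreTensor A' L' :=
  (TensorProduct.map f.toIntLinearMap g.toIntLinearMap).toAddMonoidHom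

@[simp] theorem pmap_ptmul {A' : Type*} {L' : Type*} [Ring A'] [DGRing A'] [Ring L'] [DGRing L']
    (f : A →+ A') (g : L →+ L') (a : A) (l : L) :
    pmap f g (ptmul a l) = ptmul (f a) (g l) := rfl

/-- The degree `n` part of `A ⊗_K L`, spanned by the `a ⊗ l` with `|a| + |l| = n`. -/
def tdeg (n : ℤ) : Submodule ℤ (Tensor φ ψ) :=
  Submodule.span ℤ {t | ∃ (i j : ℤ) (a : A) (l : L),
    a ∈ gr A i ∧ l ∈ gr L j ∧ i + j = n ∧ t = tmul φ ψ a l}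

/-- The differential `d(a ⊗ l) = d(a) ⊗ l + (-1)^{|a|} a ⊗ d(l)` of `A ⊗_K L`. -/
def td : Tensor φ ψ →+ Tensor φ ψ :=
  tlift φ ψ ((proj φ ψ).comp (pmap (dif A) (AddMonoidHom.id L) + pmap (signInv A) (dif L))) <| by
    intro a k l
    have h1 := tmul_balance φ ψ (dif A a) k l
    have h2 := tmul_balance φ ψ (signInv A a) (dif K k) l
    have h3 := tmul_balance φ ψ (signInv A a) (signInv K k) (dif L l)
    simp only [tmul] at h1 h2 h3
    simp only [AddMonoidHom.comp_apply, AddMonoidHom.add_apply, pmap_ptmul, d_mul, signInv_mul,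
      AddMonoidHom.id_apply, map_add, add_ptmul, ptmul_add, ← φ.map_d, ← ψ.map_d, ← map_signInv,
      h1, h2, h3]
    abel

theorem td_tmul (a : A) (l : L) :
    td φ ψ (tmul φ ψ a l) = tmul φ ψ (dif A a) l + tmul φ ψ (signInv A a) (dif L l) := rfl

/-- The left action `a (x ⊗ l) = ax ⊗ l` of `A` on `A ⊗_K L`. -/
def lact (a : A) : Tensor φ ψ →+ Tensor φ ψ :=
  tlift φ ψ ((proj φ ψ).comp (pmap (AddMonoidHom.mulLeft a) (AddMonoidHom.id L))) <| by
    intro x k l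
    have h1 := tmul_balance φ ψ (a * x) k l
    simp only [tmul] at h1
    simp [← mul_assoc, h1]

/-- The right action `(a ⊗ x) l = a ⊗ xl` of `L` on `A ⊗_K L`. -/
def ract (l : L) : Tensor φ ψ →+ Tensor φ ψ :=
  tlift φ ψ ((proj φ ψ).comp (pmap (AddMonoidHom.id A) (AddMonoidHom.mulRight l))) <| by
    intro a k x
    have h1 := tmul_balance φ ψ a k (x * l)
    simp only [tmul] at h1
    simp [mul_assoc, h1]

/-- The multiplication map `A ⊗_K A → A`, `a ⊗ b ↦ ab`. -/
def multMap : Tensor φ φ →+ A :=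
  tlift φ φ (LinearMap.mul' ℤ A).toAddMonoidHom <| by
    intro a k b
    exact mul_assoc a (φ k) b

theorem multMap_tmul (a b : A) : multMap φ (tmul φ φ a b) = a * b := rfl

/-- The dg-extension `φ : K → A` is dg-separable: the multiplication map `A ⊗_K A → A` is split by
a morphism `ρ` of dg-`A`-`A`-bimodules. -/
def DGHom.IsDGSeparable : Prop :=
  ∃ ρ : A →+ Tensor φ φ,
    (∀ (n : ℤ) (a : A), a ∈ gr A n → ρ a ∈ tdeg φ φ n) ∧
    (∀ a : A, ρ (dif A a) = td φ φ (ρ a)) ∧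
    (∀ a x b : A, ρ (a * x * b) = lact φ φ a (ract φ φ b (ρ x))) ∧
    ∀ a : A, multMap φ (ρ a) = a

theorem tmul_add (a : A) (l l' : L) : tmul φ ψ a (l + l') = tmul φ ψ a l + tmul φ ψ a l' := by
  simp only [tmul, ptmul_add, map_add]

theorem add_tmul (a a' : A) (l : L) : tmul φ ψ (a + a') l = tmul φ ψ a l + tmul φ ψ a' l := by
  simp only [tmul, add_ptmul, map_add]

theorem zero_tmul (l : L) : tmul φ ψ 0 l = 0 := by simp only [tmul, zero_ptmul, map_zero]

theorem tmul_zero (a : A) : tmul φ ψ a 0 = 0 := by simp only [tmul, ptmul_zero, map_zero]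

theorem zsmul_tmul (n : ℤ) (a : A) (l : L) : tmul φ ψ (n • a) l = n • tmul φ ψ a l := by
  simp only [tmul, zsmul_ptmul, map_zsmul]

theorem tmul_zsmul (n : ℤ) (a : A) (l : L) : tmul φ ψ a (n • l) = n • tmul φ ψ a l := by
  simp only [tmul, ptmul_zsmul, map_zsmul]

theorem tmul_mem {i j : ℤ} {a : A} {l : L} (ha : a ∈ gr A i) (hl : l ∈ gr L j) :
    tmul φ ψ a l ∈ tdeg φ ψ (i + j) :=
  Submodule.subset_span ⟨i, j, a, l, ha, hl, rfl, rfl⟩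

theorem tdeg_induction_aux {n : ℤ} {p : Tensor φ ψ → Prop} (h0 : p 0)
    (hh : ∀ i j : ℤ, i + j = n → ∀ a ∈ gr A i, ∀ l ∈ gr L j, p (tmul φ ψ a l))
    (hadd : ∀ x y, p x → p y → p (x + y)) (x : Tensor φ ψ) (hx : x ∈ tdeg φ ψ n) : p x := by
  have key : ∀ m : ℤ, p (m • x) := by
    refine Submodule.span_induction (p := fun x _ => ∀ m : ℤ, p (m • x)) ?_ ?_ ?_ ?_ hx
    · rintro _ ⟨i, j, a, l, ha, hl, hn, rfl⟩ m
      rw [← zsmul_tmul]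
      exact hh i j hn _ (zsmul_mem ha m) l hl
    · intro m
      rw [smul_zero]
      exact h0
    · intro x y _ _ hx hy m
      rw [smul_add]
      exact hadd _ _ (hx m) (hy m)
    · intro k x _ hx m
      rw [smul_smul]
      exact hx _
  simpa using key 1

theorem tdeg_induction {n : ℤ} {p : (x : Tensor φ ψ) → x ∈ tdeg φ ψ n → Prop}
    (h0 : p 0 (zero_mem _))
    (hh : ∀ (i j : ℤ) (h : i + j = n) (a : A) (ha : a ∈ gr A i) (l : L) (hl : l ∈ gr L j),
      p (tmul φ ψ a l) (h ▸ tmul_mem φ ψ ha hl))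
    (hadd : ∀ x y hx hy, p x hx → p y hy → p (x + y) (add_mem hx hy)) (x : Tensor φ ψ)
    (hx : x ∈ tdeg φ ψ n) : p x hx := by
  refine (tdeg_induction_aux φ ψ (p := fun x => ∃ h : x ∈ tdeg φ ψ n, p x h) ⟨_, h0⟩
    (fun i j h a ha l hl => ⟨_, hh i j h a ha l hl⟩) ?_ x hx).2
  rintro x y ⟨hx, px⟩ ⟨hy, py⟩
  exact ⟨_, hadd x y hx hy px py⟩

/-! #### The multiplication of `A ⊗_K L` -/

theorem mul_mem_balanced [ψ.IsGradedCentral] (x : PreTensor A L) {y : PreTensor A L}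
    (hy : y ∈ balanced φ ψ) : x * y ∈ balanced φ ψ := by
  suffices h : balanced φ ψ ≤ (balanced φ ψ).comap (AddMonoidHom.mulLeft x) from h hy
  rw [balanced, AddSubgroup.closure_le]
  rintro _ ⟨a, k, l, rfl⟩
  change x * (ptmul (a * φ k) l - ptmul a (ψ k * l)) ∈ balanced φ ψ
  rw [← proj_eq_zero, mul_sub, map_sub, sub_eq_zero]
  induction x using preTensor_induction with
  | h0 => simp only [zero_mul]
  | hadd x y hx hy => simp only [add_mul, map_add, hx, hy]
  | hh i' j' a' ha' l' hl' =>
    induction k using induction_gr with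
    | h0 => simp only [map_zero, zero_mul, mul_zero, zero_ptmul, ptmul_zero]
    | hadd x y hx hy =>
      simp only [map_add, add_mul, mul_add, add_ptmul, ptmul_add, hx, hy]
    | hh m k hk =>
      induction a using induction_gr with
      | h0 => simp only [zero_mul, mul_zero, zero_ptmul]
      | hadd x y hx hy => simp only [map_add, add_mul, mul_add, add_ptmul, hx, hy]
      | hh i a ha =>
        rw [ptmul_mul_ptmul hl' (mul_mem_gr ha (φ.map_deg hk)), ptmul_mul_ptmul hl' ha,
          map_zsmul, map_zsmul, ← mul_assoc, ← mul_assoc]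
        have h1 := tmul_balance φ ψ (a' * a) k (l' * l)
        rw [← mul_assoc, DGHom.IsGradedCentral.comm hk hl', smul_mul_assoc, tmul_zsmul] at h1
        simp only [tmul] at h1
        rw [h1, smul_smul, mul_add, sgn_add, mul_comm m j', mul_assoc, sgn_sq, mul_one]

theorem balanced_mul_mem [φ.IsGradedCentral] {x : PreTensor A L} (y : PreTensor A L)
    (hx : x ∈ balanced φ ψ) : x * y ∈ balanced φ ψ := by
  suffices h : balanced φ ψ ≤ (balanced φ ψ).comap (AddMonoidHom.mulRight y) from h hx
  rw [balanced, AddSubgroup.closure_le]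
  rintro _ ⟨a, k, l, rfl⟩
  change (ptmul (a * φ k) l - ptmul a (ψ k * l)) * y ∈ balanced φ ψ
  rw [← proj_eq_zero, sub_mul, map_sub, sub_eq_zero]
  induction y using preTensor_induction with
  | h0 => simp only [mul_zero]
  | hadd x y hx hy => simp only [mul_add, map_add, hx, hy]
  | hh i' j' a' ha' l' hl' =>
    induction k using induction_gr with
    | h0 => simp only [map_zero, zero_mul, mul_zero, zero_ptmul, ptmul_zero]
    | hadd x y hx hy =>
      simp only [map_add, add_mul, mul_add, add_ptmul, ptmul_add, hx, hy]
    | hh m k hk =>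
      induction l using induction_gr with
      | h0 => simp only [zero_mul, mul_zero, ptmul_zero]
      | hadd x y hx hy => simp only [map_add, add_mul, mul_add, ptmul_add, hx, hy]
      | hh i l hl =>
        rw [ptmul_mul_ptmul hl ha', ptmul_mul_ptmul (mul_mem_gr (ψ.map_deg hk) hl) ha',
          map_zsmul, map_zsmul, mul_assoc, mul_assoc]
        have h1 := tmul_balance φ ψ (a * a') k (l * l')
        rw [DGHom.IsGradedCentral.comm hk ha', mul_smul_comm, zsmul_ptmul, map_zsmul, ← mul_assoc a a']
        simp only [tmul] at h1
        rw [h1, smul_smul, add_mul, sgn_add, mul_comm (sgn (m * i'))]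

/-! #### The grading of `A ⊗_K L` -/

/-- The homogeneous components of an element of a dg-ring. -/
def comps (A : Type u) [Ring A] [DGRing A] : A →ₗ[ℤ] (ℤ →₀ A) :=
  (DirectSum.toModule ℤ ℤ (ℤ →₀ A) fun i => Finsupp.lsingle i ∘ₗ (gr A i).subtype) ∘ₗ
    (DirectSum.decomposeLinearEquiv (gr A)).toLinearMap

theorem comps_of_mem {A : Type u} [Ring A] [DGRing A] {i : ℤ} {a : A} (ha : a ∈ gr A i) :
    comps A a = Finsupp.single i a := by
  have h := DirectSum.decompose_of_mem (gr A) ha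
  simp only [comps, LinearMap.comp_apply, LinearEquiv.coe_coe, DirectSum.decomposeLinearEquiv_apply,
    h]
  rw [← DirectSum.lof_eq_of ℤ, DirectSum.toModule_lof]
  simp

/-- The homogeneous components of an element of `A ⊗_ℤ L`, projected to `A ⊗_K L`. -/
def pcomps : PreTensor A L →+ (ℤ →₀ Tensor φ ψ) :=
  (Finsupp.mapRange.addMonoidHom (proj φ ψ)).comp
    (Finsupp.lmapDomain (A ⊗[ℤ] L) ℤ (fun p : ℤ × ℤ => p.1 + p.2) ∘ₗ
      (finsuppTensorFinsupp ℤ ℤ A L ℤ ℤ).toLinearMap ∘ₗ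
        TensorProduct.map (comps A) (comps L)).toAddMonoidHom

theorem pcomps_ptmul {i j : ℤ} {a : A} {l : L} (ha : a ∈ gr A i) (hl : l ∈ gr L j) :
    pcomps φ ψ (ptmul a l) = Finsupp.single (i + j) (tmul φ ψ a l) := by
  have h : Finsupp.lmapDomain (A ⊗[ℤ] L) ℤ (fun p : ℤ × ℤ => p.1 + p.2)
      (finsuppTensorFinsupp ℤ ℤ A L ℤ ℤ (comps A a ⊗ₜ comps L l)) =
        Finsupp.single (i + j) (a ⊗ₜ[ℤ] l) := by
    rw [comps_of_mem ha, comps_of_mem hl, finsuppTensorFinsupp_single, Finsupp.lmapDomain_apply,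
      Finsupp.mapDomain_single]
  exact (congrArg (Finsupp.mapRange.addMonoidHom (M := PreTensor A L) (proj φ ψ)) h).trans
    (Finsupp.mapRange_single (hf := map_zero (proj φ ψ)))

/-- The homogeneous components of an element of `A ⊗_K L`. -/
def tcomps : Tensor φ ψ →+ (ℤ →₀ Tensor φ ψ) :=
  tlift φ ψ (pcomps φ ψ) <| by
    intro a k l
    induction a using induction_gr with
    | h0 => simp only [zero_mul, zero_ptmul]
    | hadd x y hx hy => simp only [map_add, add_mul, add_ptmul, hx, hy]
    | hh i a ha =>
    induction k using induction_gr with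
    | h0 => simp only [map_zero, zero_mul, mul_zero, zero_ptmul, ptmul_zero]
    | hadd x y hx hy =>
      simp only [map_add, add_mul, mul_add, add_ptmul, ptmul_add, hx, hy]
    | hh m k hk =>
    induction l using induction_gr with
    | h0 => simp only [mul_zero, ptmul_zero]
    | hadd x y hx hy => simp only [map_add, mul_add, ptmul_add, hx, hy]
    | hh j l hl =>
    rw [pcomps_ptmul φ ψ (mul_mem_gr ha (φ.map_deg hk)) hl,
      pcomps_ptmul φ ψ ha (mul_mem_gr (ψ.map_deg hk) hl), tmul_balance, add_assoc]

theorem tcomps_tmul {i j : ℤ} {a : A} {l : L} (ha : a ∈ gr A i) (hl : l ∈ gr L j) :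
    tcomps φ ψ (tmul φ ψ a l) = Finsupp.single (i + j) (tmul φ ψ a l) := pcomps_ptmul φ ψ ha hl

@[reducible] def tensorDecomposition : DirectSum.Decomposition (tdeg φ ψ) :=
  decompositionOfComponents (tdeg φ ψ) (tcomps φ ψ)
    (by
      intro x n
      induction x using tensor_induction with
      | h0 => rw [map_zero]; exact zero_mem _
      | hadd x y hx hy => rw [map_add]; exact add_mem hx hy
      | hh i j a ha l hl =>
        rw [tcomps_tmul φ ψ ha hl, Finsupp.single_apply]
        split_ifs with h
        · exact h ▸ tmul_mem φ ψ ha hl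
        · exact zero_mem _)
    (by
      intro x
      induction x using tensor_induction with
      | h0 => rw [map_zero]; exact Finsupp.sum_zero_index
      | hadd x y hx hy =>
        rw [map_add, Finsupp.sum_add_index' (fun _ => rfl) (fun _ _ _ => rfl), hx, hy]
      | hh i j a ha l hl =>
        rw [tcomps_tmul φ ψ ha hl, Finsupp.sum_single_index rfl])
    (by
      intro n x hx
      induction x, hx using tdeg_induction with
      | h0 => rw [map_zero, Finsupp.single_zero]
      | hadd x y _ _ hx hy => rw [map_add, hx, hy, Finsupp.single_add]
      | hh i j h a ha l hl => rw [tcomps_tmul φ ψ ha hl, h])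

theorem td_mem {n : ℤ} {x : Tensor φ ψ} (hx : x ∈ tdeg φ ψ n) : td φ ψ x ∈ tdeg φ ψ (n + 1) := by
  induction x, hx using tdeg_induction with
  | h0 => rw [map_zero]; exact zero_mem _
  | hadd x y _ _ hx hy => rw [map_add]; exact add_mem hx hy
  | hh i j h a ha l hl =>
    rw [td_tmul]
    refine add_mem ?_ ?_
    · have := tmul_mem φ ψ (DGRing.d_mem ha) hl
      rwa [show i + 1 + j = n + 1 by omega] at this
    · have := tmul_mem φ ψ (signInv_mem ha) (DGRing.d_mem hl)
      rwa [show i + (j + 1) = n + 1 by omega] at this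

theorem td_td (x : Tensor φ ψ) : td φ ψ (td φ ψ x) = 0 := by
  induction x using tensor_induction with
  | h0 => simp only [map_zero]
  | hadd x y hx hy => rw [map_add, map_add, hx, hy, add_zero]
  | hh i j a ha l hl =>
    rw [td_tmul, map_add, td_tmul, td_tmul, DGRing.d_d, DGRing.d_d, d_signInv, zero_tmul,
      tmul_zero, ← neg_one_zsmul, zsmul_tmul, neg_one_zsmul]
    abel

variable [φ.IsGradedCentral] [ψ.IsGradedCentral]

/-- The multiplication of `A ⊗_K L`, induced from that of `A ⊗_ℤ L`. -/
def mulHom : Tensor φ ψ →+ Tensor φ ψ →+ Tensor φ ψ :=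
  QuotientAddGroup.lift (balanced φ ψ)
    (AddMonoidHom.mk' (fun x : PreTensor A L =>
      (QuotientAddGroup.lift (balanced φ ψ) ((proj φ ψ).comp (AddMonoidHom.mulLeft x))
        (fun y hy => (proj_eq_zero φ ψ).2 (mul_mem_balanced φ ψ x hy)) :
          Tensor φ ψ →+ Tensor φ ψ))
      (fun x x' => by
        ext t
        obtain ⟨y, rfl⟩ := proj_surjective φ ψ t
        change proj φ ψ ((x + x') * y) = proj φ ψ (x * y) + proj φ ψ (x' * y)
        rw [add_mul, map_add]))
    (fun x hx => by
      ext t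
      obtain ⟨y, rfl⟩ := proj_surjective φ ψ t
      exact (proj_eq_zero φ ψ).2 (balanced_mul_mem φ ψ y hx))

instance : Mul (Tensor φ ψ) := ⟨fun x y => mulHom φ ψ x y⟩

instance : One (Tensor φ ψ) := ⟨tmul φ ψ 1 1⟩

theorem proj_mul (x y : PreTensor A L) : proj φ ψ (x * y) = proj φ ψ x * proj φ ψ y := rfl

theorem proj_one : proj φ ψ 1 = 1 := rfl

/-- The ring `A ⊗_K L`. -/
instance : Ring (Tensor φ ψ) :=
  { (inferInstance : AddCommGroup (Tensor φ ψ)), (inferInstance : Mul (Tensor φ ψ)),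
    (inferInstance : One (Tensor φ ψ)) with
    left_distrib := fun x y z => map_add (mulHom φ ψ x) y z
    right_distrib := fun x y z => by
      change mulHom φ ψ (x + y) z = mulHom φ ψ x z + mulHom φ ψ y z
      rw [map_add, AddMonoidHom.add_apply]
    zero_mul := fun x => by
      change mulHom φ ψ 0 x = 0
      rw [map_zero, AddMonoidHom.zero_apply]
    mul_zero := fun x => map_zero (mulHom φ ψ x)
    mul_assoc := fun x y z => by
      obtain ⟨x, rfl⟩ := proj_surjective φ ψ x
      obtain ⟨y, rfl⟩ := proj_surjective φ ψ y
      obtain ⟨z, rfl⟩ := proj_surjective φ ψ z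
      simp only [← proj_mul, mul_assoc]
    one_mul := fun x => by
      obtain ⟨x, rfl⟩ := proj_surjective φ ψ x
      rw [← proj_one, ← proj_mul, one_mul]
    mul_one := fun x => by
      obtain ⟨x, rfl⟩ := proj_surjective φ ψ x
      rw [← proj_one, ← proj_mul, mul_one] }

theorem tmul_mul_tmul {i j : ℤ} {l : L} {a' : A} (hl : l ∈ gr L i) (ha : a' ∈ gr A j)
    (a : A) (l' : L) :
    tmul φ ψ a l * tmul φ ψ a' l' = sgn (i * j) • tmul φ ψ (a * a') (l * l') := by
  simp only [tmul, ← proj_mul, ptmul_mul_ptmul hl ha, map_zsmul]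

theorem td_mul {n : ℤ} {x : Tensor φ ψ} (hx : x ∈ tdeg φ ψ n) (y : Tensor φ ψ) :
    td φ ψ (x * y) = td φ ψ x * y + sgn n • (x * td φ ψ y) := by
  induction x, hx using tdeg_induction with
  | h0 => simp only [zero_mul, map_zero, smul_zero, add_zero]
  | hadd x y _ _ hx hy => simp only [add_mul, map_add, hx, hy, smul_add]; abel
  | hh i j h a ha l hl =>
    induction y using tensor_induction with
    | h0 => simp only [mul_zero, map_zero, smul_zero, add_zero]
    | hadd x y hx hy => simp only [mul_add, map_add, hx, hy, smul_add]; abel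
    | hh i' j' a' ha' l' hl' =>
      subst h
      rw [tmul_mul_tmul φ ψ hl ha', map_zsmul, td_tmul, td_tmul, td_tmul, add_mul, mul_add,
        tmul_mul_tmul φ ψ hl ha', tmul_mul_tmul φ ψ (DGRing.d_mem hl) ha',
        tmul_mul_tmul φ ψ hl (DGRing.d_mem ha'), tmul_mul_tmul φ ψ hl (signInv_mem ha'),
        signInv_mul, d_mul, d_mul, signInv_of_mem ha, signInv_of_mem ha', signInv_of_mem hl]
      simp only [add_tmul, tmul_add, smul_mul_assoc, mul_smul_comm, zsmul_tmul, tmul_zsmul,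
        smul_add, smul_smul, sgn_add, mul_add, add_mul, mul_one, one_mul]
      rw [show sgn (j * i') * (sgn i' * sgn i) = sgn (j * i') * sgn i' * sgn i by ring,
        show sgn (j * i') * (sgn j * (sgn i' * sgn i)) =
          sgn i * sgn j * (sgn (j * i') * sgn i') by ring,
        show sgn i * sgn j * (sgn (j * i') * sgn j) = sgn (j * i') * sgn i by
          linear_combination (sgn (j * i') * sgn i) * sgn_sq j]
      abel

/-- The dg-ring `A ⊗_K L`. -/
instance : DGRing (Tensor φ ψ) where
  deg := tdeg φ ψ
  gradedAlgebra :=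
    { (tensorDecomposition φ ψ : DirectSum.Decomposition (tdeg φ ψ)) with
      one_mem := by
        have := tmul_mem φ ψ (one_mem_gr (A := A)) (one_mem_gr (A := L))
        rwa [add_zero] at this
      mul_mem := by
        intro m n x y hx hy
        induction x, hx using tdeg_induction with
        | h0 => rw [zero_mul]; exact zero_mem _
        | hadd x y _ _ hx hy => rw [add_mul]; exact add_mem hx hy
        | hh i j h a ha l hl =>
          induction y, hy using tdeg_induction with
          | h0 => rw [mul_zero]; exact zero_mem _
          | hadd x y _ _ hx hy => rw [mul_add]; exact add_mem hx hy
          | hh i' j' h' a' ha' l' hl' =>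
            rw [tmul_mul_tmul φ ψ hl ha']
            have := tmul_mem φ ψ (mul_mem_gr ha ha') (mul_mem_gr hl hl')
            rw [show i + i' + (j + j') = m + n by omega] at this
            exact zsmul_mem this _ }
  d := td φ ψ
  d_mem := td_mem φ ψ
  d_d := td_td φ ψ
  leibniz := td_mul φ ψ

/-- The morphism of dg-rings `L → A ⊗_K L`, `l ↦ 1 ⊗ l`. -/
def inclRight : DGHom L (Tensor φ ψ) where
  toFun l := tmul φ ψ 1 l
  map_one' := rfl
  map_zero' := tmul_zero φ ψ 1
  map_add' := tmul_add φ ψ 1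
  map_mul' l l' := by
    induction l using induction_gr with
    | h0 => simp only [zero_mul, tmul_zero]
    | hadd x y hx hy => simp only [add_mul, tmul_add, hx, hy]
    | hh i l hl =>
      rw [tmul_mul_tmul φ ψ hl (one_mem_gr (A := A)), mul_zero, sgn_zero, one_smul, one_mul]
  map_deg {i l} hl := by
    have := tmul_mem φ ψ (one_mem_gr (A := A)) hl
    rwa [zero_add] at this
  map_d l := by
    change tmul φ ψ 1 (dif L l) = td φ ψ (tmul φ ψ 1 l)
    rw [td_tmul, d_one, zero_tmul, zero_add, signInv_of_mem (one_mem_gr (A := A)), sgn_zero,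
      one_smul]

end Tensor

/-! ### Differential graded modules -/

/-- A (left) dg-module over the dg-ring `R`: a `ℤ`-graded `R`-module with a differential `d` of
degree `1` such that `d² = 0` and `d(rm) = d(r)m + (-1)^{|r|} r d(m)` for homogeneous `r`. -/
class DGModule (R : Type u) [Ring R] [DGRing R] (M : Type v) [AddCommGroup M] [Module R M] where
  deg : ℤ → AddSubgroup M
  decomposition : DirectSum.Decomposition deg
  smul_mem : ∀ {i j : ℤ} {r : R} {m : M}, r ∈ gr R i → m ∈ deg j → r • m ∈ deg (i + j)
  d : M →+ M
  d_mem : ∀ {i : ℤ} {m : M}, m ∈ deg i → d m ∈ deg (i + 1)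
  d_d : ∀ m : M, d (d m) = 0
  leibniz : ∀ {i : ℤ} {r : R}, r ∈ gr R i → ∀ m : M, d (r • m) = dif R r • m + sgn i • (r • d m)

attribute [reducible, instance] DGModule.decomposition

/-- The homogeneous components of a dg-module. -/
abbrev mgr (R : Type u) [Ring R] [DGRing R] (M : Type v) [AddCommGroup M] [Module R M]
    [DGModule R M] : ℤ → AddSubgroup M := DGModule.deg R

/-- The differential of a dg-module. -/
abbrev mdif (R : Type u) [Ring R] [DGRing R] (M : Type v) [AddCommGroup M] [Module R M]
    [DGModule R M] : M →+ M := DGModule.d R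

section Modules

variable (R : Type u) [Ring R] [DGRing R]

/-- A morphism of dg-modules: `R`-linear, of degree `0`, commuting with the differentials. -/
structure DGModuleHom (M : Type v) [AddCommGroup M] [Module R M] [DGModule R M]
    (N : Type w) [AddCommGroup N] [Module R N] [DGModule R N] extends M →ₗ[R] N where
  map_deg : ∀ {i : ℤ} {m : M}, m ∈ mgr R M i → toLinearMap m ∈ mgr R N i
  map_d : ∀ m : M, toLinearMap (mdif R M m) = mdif R N (toLinearMap m)

/-- `M` is a direct summand of `N` in the category of dg-modules over `R`. -/
def IsDirectSummand (M : Type v) [AddCommGroup M] [Module R M] [DGModule R M]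
    (N : Type w) [AddCommGroup N] [Module R N] [DGModule R N] : Prop :=
  ∃ (ι : DGModuleHom R M N) (π : DGModuleHom R N M), ∀ m : M, π.toLinearMap (ι.toLinearMap m) = m

theorem mdif_smul {M : Type v} [AddCommGroup M] [Module R M] [DGModule R M] (r : R) (m : M) :
    mdif R M (r • m) = dif R r • m + signInv R r • mdif R M m := by
  induction r using induction_gr with
  | h0 => simp
  | hadd a b ha hb => simp [ha, hb, add_smul]; abel
  | hh i r hr => rw [DGModule.leibniz hr, signInv_of_mem hr, smul_assoc]

/-- The module `ker δ` of cycles of a dg-module, over the ring `ker d` of cycles. -/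
def mcycles (M : Type v) [AddCommGroup M] [Module R M] [DGModule R M] :
    Submodule (cycles R) M where
  carrier := {m | mdif R M m = 0}
  zero_mem' := map_zero _
  add_mem' ha hb := by
    simp only [Set.mem_ofPred_eq] at *
    rw [map_add, ha, hb, add_zero]
  smul_mem' c m hm := by
    have hc : dif R (c : R) = 0 := c.2
    simp only [Set.mem_ofPred_eq] at *
    change mdif R M ((c : R) • m) = 0
    rw [mdif_smul, hc, hm, zero_smul, smul_zero, add_zero]

/-- The underlying set of the free dg-module with a basis indexed by `I` whose element with
index `i` is a cycle of degree `e i`: the direct sum of copies of `R` indexed by `I`, where the copy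
with index `i` is shifted so that its generator has degree `e i`. -/
@[nolint unusedArguments]
def Free {I : Type v} (_e : I → ℤ) : Type (max u v) := I →₀ R

variable {I : Type v} (e : I → ℤ)

instance : AddCommGroup (Free R e) := inferInstanceAs (AddCommGroup (I →₀ R))

instance : Module R (Free R e) := inferInstanceAs (Module R (I →₀ R))

/-- The coefficient of a generator in an element of the free dg-module. -/
def coeff (i : I) : Free R e →+ R := Finsupp.applyAddHom i

/-- The multiple `r • e_i` of the generator `e_i` in the free dg-module. -/
def fsingle (i : I) : R →+ Free R e := Finsupp.singleAddHom i

theorem coeff_fsingle [DecidableEq I] (i j : I) (r : R) :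
    coeff R e j (fsingle R e i r) = if i = j then r else 0 := Finsupp.single_apply

theorem coeff_ext {x y : Free R e} (h : ∀ i, coeff R e i x = coeff R e i y) : x = y :=
  Finsupp.ext h

/-- The homogeneous components of the elements of the free dg-module. -/
def freeComps : Free R e →+ (ℤ →₀ Free R e) :=
  Finsupp.liftAddHom (M := R) (N := ℤ →₀ Free R e) fun i =>
    (Finsupp.mapRange.addMonoidHom (fsingle R e i)).comp
      ((Finsupp.mapDomain.addMonoidHom (fun n : ℤ => n + e i)).comp (comps R).toAddMonoidHom)

/-- The degree `n` part of the free dg-module: the coefficient of the generator of degree `e i` has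
degree `n - e i`. -/
def freeDeg (n : ℤ) : AddSubgroup (Free R e) where
  carrier := {x | ∀ i, coeff R e i x ∈ gr R (n - e i)}
  zero_mem' i := by rw [map_zero]; exact zero_mem _
  add_mem' ha hb i := by rw [map_add]; exact add_mem (ha i) (hb i)
  neg_mem' ha i := by rw [map_neg]; exact neg_mem (ha i)

theorem freeComps_fsingle {n : ℤ} {r : R} (hr : r ∈ gr R n) (i : I) :
    freeComps R e (fsingle R e i r) = Finsupp.single (n + e i) (fsingle R e i r) := by
  refine (Finsupp.liftAddHom_apply_single (M := R) (N := ℤ →₀ Free R e) _ i r).trans ?_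
  have h : Finsupp.mapDomain (fun n : ℤ => n + e i) (comps R r) = Finsupp.single (n + e i) r := by
    rw [comps_of_mem hr, Finsupp.mapDomain_single]
  exact (congrArg (Finsupp.mapRange.addMonoidHom (fsingle R e i)) h).trans
    (Finsupp.mapRange_single (hf := map_zero (fsingle R e i)))

theorem fsingle_mem {n : ℤ} {r : R} (hr : r ∈ gr R n) (i : I) :
    fsingle R e i r ∈ freeDeg R e (n + e i) := by
  classical
  intro j
  rw [coeff_fsingle]
  split_ifs with h
  · subst h
    rwa [add_sub_cancel_right]
  · exact zero_mem _

theorem free_induction {p : Free R e → Prop} (h0 : p 0)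
    (hh : ∀ i : I, ∀ n : ℤ, ∀ r ∈ gr R n, p (fsingle R e i r))
    (hadd : ∀ x y, p x → p y → p (x + y)) (x : Free R e) : p x := by
  refine Finsupp.induction_linear (motive := p) x h0 hadd fun i r => ?_
  change p (fsingle R e i r)
  induction r using induction_gr with
  | h0 => rw [map_zero]; exact h0
  | hadd a b ha hb => rw [map_add]; exact hadd _ _ ha hb
  | hh n r hr => exact hh i n r hr

theorem sum_fsingle (x : Free R e) :
    ∃ s : Finset I, x = ∑ i ∈ s, fsingle R e i (coeff R e i x) :=
  ⟨_, (Finsupp.sum_single (M := R) (α := I) x).symm⟩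

@[reducible] def freeDecomposition : DirectSum.Decomposition (freeDeg R e) :=
  decompositionOfComponents (freeDeg R e) (freeComps R e)
    (by
      intro x n
      induction x using free_induction with
      | h0 => rw [map_zero]; exact zero_mem _
      | hadd x y hx hy => rw [map_add]; exact add_mem hx hy
      | hh i m r hr =>
        rw [freeComps_fsingle R e hr, Finsupp.single_apply]
        split_ifs with h
        · exact h ▸ fsingle_mem R e hr i
        · exact zero_mem _)
    (by
      intro x
      induction x using free_induction with
      | h0 => rw [map_zero]; exact Finsupp.sum_zero_index
      | hadd x y hx hy =>
        rw [map_add, Finsupp.sum_add_index' (fun _ => rfl) (fun _ _ _ => rfl), hx, hy]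
      | hh i m r hr =>
        rw [freeComps_fsingle R e hr]
        exact Finsupp.sum_single_index rfl)
    (by
      intro n x hx
      obtain ⟨s, hs⟩ := sum_fsingle R e x
      have h : ∀ i, freeComps R e (fsingle R e i (coeff R e i x)) =
          Finsupp.singleAddHom n (fsingle R e i (coeff R e i x)) := by
        intro i
        rw [freeComps_fsingle R e (hx i), sub_add_cancel]
        rfl
      change freeComps R e x = Finsupp.singleAddHom n x
      rw [hs, map_sum, map_sum]
      refine Finset.sum_congr rfl fun i _ => ?_
      exact h i)

/-- The free dg-module with a basis of cycles of degrees `e i`. -/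
instance : DGModule R (Free R e) where
  deg := freeDeg R e
  decomposition := freeDecomposition R e
  smul_mem {m n r x} hr hx i := by
    change r * coeff R e i x ∈ _
    rw [add_sub_assoc]
    exact mul_mem_gr hr (hx i)
  d := Finsupp.mapRange.addMonoidHom (dif R)
  d_mem {n x} hx i := by
    change dif R (coeff R e i x) ∈ _
    rw [add_sub_right_comm]
    exact DGRing.d_mem (hx i)
  d_d x := coeff_ext R e fun i => DGRing.d_d (coeff R e i x)
  leibniz {n r} hr x := coeff_ext R e fun i => DGRing.leibniz hr (coeff R e i x)

end Modules

section Restriction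

variable {R : Type u} {S : Type v} [Ring R] [DGRing R] [Ring S] [DGRing S] (f : DGHom R S)
  (M : Type w) [AddCommGroup M] [Module S M]

/-- The restriction of the `S`-module `M` along `f : R → S`. -/
@[nolint unusedArguments]
def Restrict (_f : DGHom R S) (M : Type w) : Type w := M

instance : AddCommGroup (Restrict f M) := inferInstanceAs (AddCommGroup M)

instance : Module R (Restrict f M) := Module.compHom M f.toRingHom

/-- The restriction of a dg-module along a morphism of dg-rings. -/
instance [DGModule S M] : DGModule R (Restrict f M) where
  deg := mgr S M
  decomposition := DGModule.decomposition (R := S) (M := M)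
  smul_mem hr hm := DGModule.smul_mem (R := S) (M := M) (f.map_deg hr) hm
  d := mdif S M
  d_mem hm := DGModule.d_mem (R := S) (M := M) hm
  d_d := DGModule.d_d (R := S) (M := M)
  leibniz {i r} hr m := by
    have := DGModule.leibniz (R := S) (M := M) (f.map_deg hr) m
    rw [← f.map_d] at this
    exact this

end Restriction

end DG

end

set_option linter.unusedSectionVars false

/-! ### Homogeneous components under additive maps. -/

namespace DG

/-! Since `K` is acyclic, `1` is a boundary in `K`, hence in `L`: there is `x` in `L` of degree `-1`
with `d x = 1`. Multiplication by `x` is then a contracting homotopy on every dg-module `N` over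
`L`, with `n = d(x n) + x d(n)`, so `N` is generated over `L` by its cycles. As `L` is a dg-division
ring, nonzero homogeneous cycles of `L` are invertible among the cycles, so `ker δ` has a
homogeneous basis over `ker d_L` (`exists_homogeneous_basis_mcycles`). Such a basis is also a basis
of `N` over `L`, which makes `N` a free dg-module on cycles (`freeDesc_bijective`).

Apply this to `M` restricted to `L`. The basis defines a morphism `π` from the free dg-module over
`A ⊗_K L` to `M`. Its restriction to the free dg-module over `L` on the same generators is an
isomorphism `f`, so the inverse of `f` followed by the inclusion is an `L`-linear section `σ` of
`π`.

Separability upgrades `σ` to a section over `A ⊗_K L`, by a Maschke-type averaging. If `ρ` splits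
the multiplication and `ρ 1 = ∑ a_i ⊗ a_i'`, the new section is `m ↦ ∑ a_i σ(a_i' m)`. It is
`A`-linear because `a ρ(1) = ρ(a) = ρ(1) a`; it commutes with `L` without sign and preserves degrees
because `ρ 1` has degree `0`; it commutes with the differentials because `ρ 1` is a cycle; and it is
a section because `∑ a_i a_i' = 1` (`IsDGSeparable.isDirectSummand`).

If `d_L = 0`, then `1 = d x = 0` in `L`, so `M = 0`. -/

/-- An additive map of degree `k` commutes with taking homogeneous components, up to a shift of the
degree by `k`. -/
theorem map_decompose {X Y σ τ : Type*} [AddCommGroup X] [AddCommGroup Y] [SetLike σ X]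
    [AddSubgroupClass σ X] [SetLike τ Y] [AddSubgroupClass τ Y] (N : ℤ → σ) (P : ℤ → τ)
    [DirectSum.Decomposition N] [DirectSum.Decomposition P] (f : X →+ Y) (k : ℤ)
    (hf : ∀ {i : ℤ} {x : X}, x ∈ N i → f x ∈ P (i + k)) (x : X) (n : ℤ) :
    f (DirectSum.decompose N x n) = DirectSum.decompose P (f x) (n + k) := by
  induction x using DirectSum.Decomposition.inductionOn N with
  | zero => simp
  | add a b ha hb => simp [DirectSum.decompose_add, ha, hb]
  | @homogeneous i m =>
    by_cases h : i = n
    · subst h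
      rw [DirectSum.decompose_of_mem_same N m.2, DirectSum.decompose_of_mem_same P (hf m.2)]
    · rw [DirectSum.decompose_of_mem_ne N m.2 h,
        DirectSum.decompose_of_mem_ne P (hf m.2) (by omega), map_zero]

theorem eq_of_decompose_eq {X σ : Type*} [AddCommGroup X] [SetLike σ X] [AddSubgroupClass σ X]
    (N : ℤ → σ) [DirectSum.Decomposition N] {x y : X}
    (h : ∀ n, (DirectSum.decompose N x n : X) = DirectSum.decompose N y n) : x = y := by
  apply (DirectSum.decompose N).injective
  ext n
  exact h n

/-- An injective additive map of degree `0` reflects degrees. -/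
theorem mem_of_map_mem {X Y σ τ : Type*} [AddCommGroup X] [AddCommGroup Y] [SetLike σ X]
    [AddSubgroupClass σ X] [SetLike τ Y] [AddSubgroupClass τ Y] (N : ℤ → σ) (P : ℤ → τ)
    [DirectSum.Decomposition N] [DirectSum.Decomposition P] (f : X →+ Y)
    (hf : ∀ {i : ℤ} {x : X}, x ∈ N i → f x ∈ P i) (hinj : Function.Injective f) {x : X} {n : ℤ}
    (hx : f x ∈ P n) : x ∈ N n := by
  -- An element is homogeneous of degree `n` when it equals its own component of degree `n`, and
  -- injectivity lets this be tested after `f`.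
  have h : (DirectSum.decompose N x n : X) = x := by
    apply hinj
    rw [map_decompose N P f 0 (fun h => by rw [add_zero]; exact hf h), add_zero, DirectSum.decompose_of_mem_same P hx]
  exact h ▸ SetLike.coe_mem _

/-! ### Cycles of dg-division rings, and homogeneous bases of cycles of dg-modules. -/

section Ring

variable {R : Type u} [Ring R] [DGRing R]

/-- The right multiplication by a homogeneous cycle has a dg-left ideal as its image. -/
theorem isDGLeftIdeal_range_mulRight {i : ℤ} {z : R} (hz : z ∈ gr R i) (hdz : dif R z = 0) :
    IsDGLeftIdeal (AddMonoidHom.mulRight z).range := by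
  refine ⟨⟨?_, ?_⟩, ?_⟩
  · rintro _ ⟨r, rfl⟩ n
    refine ⟨DirectSum.decompose (gr R) r (n - i), ?_⟩
    rw [map_decompose (gr R) (gr R) (AddMonoidHom.mulRight z) i (fun h => mul_mem_gr h hz),
      sub_add_cancel]
  · rintro _ ⟨r, rfl⟩
    exact ⟨dif R r, by simp [d_mul, hdz]⟩
  · rintro a _ ⟨r, rfl⟩
    exact ⟨a * r, mul_assoc a r z⟩

/-- The left annihilator of a homogeneous cycle is a dg-left ideal. -/
theorem isDGLeftIdeal_ker_mulRight {i : ℤ} {z : R} (hz : z ∈ gr R i) (hdz : dif R z = 0) :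
    IsDGLeftIdeal (AddMonoidHom.mulRight z).ker := by
  refine ⟨⟨?_, ?_⟩, ?_⟩
  · intro r hr n
    rw [AddMonoidHom.mem_ker] at hr ⊢
    rw [map_decompose (gr R) (gr R) (AddMonoidHom.mulRight z) i (fun h => mul_mem_gr h hz), hr]
    simp
  · intro r hr
    have h := d_mul r z
    change r * z = 0 at hr
    change dif R r * z = 0
    rwa [hr, map_zero, hdz, mul_zero, add_zero, eq_comm] at h
  · intro a r hr
    change r * z = 0 at hr
    change a * r * z = 0
    rw [mul_assoc, hr, mul_zero]

/-- The cycles of a dg-division ring form a graded division ring. -/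
theorem IsDGDivision.exists_cycle_mul_eq_one (hR : IsDGDivision R) {i : ℤ} {z : R}
    (hz : z ∈ gr R i) (hdz : dif R z = 0) (hz0 : z ≠ 0) : ∃ w : R, dif R w = 0 ∧ w * z = 1 := by
  -- The left ideal `R z` contains `z ≠ 0`, so it is everything; the left annihilator of `z` does
  -- not contain `1`, so it is zero.
  have htop : (AddMonoidHom.mulRight z).range = ⊤ := by
    refine (hR.1 _ (isDGLeftIdeal_range_mulRight hz hdz)).resolve_left fun h => hz0 ?_
    have : z ∈ (AddMonoidHom.mulRight z).range := ⟨1, one_mul z⟩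
    rwa [h, AddSubgroup.mem_bot] at this
  have hbot : (AddMonoidHom.mulRight z).ker = ⊥ := by
    refine (hR.1 _ (isDGLeftIdeal_ker_mulRight hz hdz)).resolve_right fun h => hz0 ?_
    have : (1 : R) ∈ (AddMonoidHom.mulRight z).ker := h ▸ AddSubgroup.mem_top _
    simpa using this
  obtain ⟨w, hw⟩ : (1 : R) ∈ (AddMonoidHom.mulRight z).range := htop ▸ AddSubgroup.mem_top _
  change w * z = 1 at hw
  refine ⟨w, ?_, hw⟩
  -- Differentiating `w z = 1` gives `d(w) z = 0`, because `z` and `1` are cycles; so `d w` lies in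
  -- the zero annihilator.
  have h : dif R w ∈ (AddMonoidHom.mulRight z).ker := by
    have h := d_mul w z
    rw [hw, d_one, hdz, mul_zero, add_zero] at h
    exact h.symm
  rwa [hbot, AddSubgroup.mem_bot] at h

/-- In an acyclic dg-ring the unit is the boundary of an element of degree `-1`. -/
theorem IsAcyclic.exists_d_eq_one (hR : IsAcyclic R) : ∃ x ∈ gr R (-1), dif R x = 1 := by
  obtain ⟨x, hx⟩ := hR 1 d_one
  -- A preimage of `1` need not be homogeneous; since `d` has degree `1` and `1` has degree `0`,
  -- only its component of degree `-1` matters.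
  refine ⟨DirectSum.decompose (gr R) x (-1), SetLike.coe_mem _, ?_⟩
  rw [map_decompose (gr R) (gr R) (dif R) 1 DGRing.d_mem, hx]
  exact DirectSum.decompose_of_mem_same (gr R) one_mem_gr

theorem DGHom.exists_d_eq_one {S : Type v} [Ring S] [DGRing S] (f : DGHom R S)
    (hR : IsAcyclic R) : ∃ x ∈ gr S (-1), dif S x = 1 := by
  obtain ⟨x, hx, hdx⟩ := hR.exists_d_eq_one
  exact ⟨f x, f.map_deg hx, by rw [← f.map_d, hdx, map_one]⟩

variable {M : Type v} [AddCommGroup M] [Module R M] [DGModule R M]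

/-- Multiplication by `x` is a contracting homotopy: `m = d(x m) + x d(m)` writes each `m` through
the two cycles `d(x m)` and `d(m)`. -/
theorem mdif_smul_of_mem {x : R} (hx : x ∈ gr R (-1)) (hdx : dif R x = 1) (m : M) :
    mdif R M (x • m) = m - x • mdif R M m := by
  rw [mdif_smul, hdx, signInv_of_mem hx]
  simp [sgn, sub_eq_add_neg]

theorem dif_decompose_eq_zero {a : R} (ha : dif R a = 0) (n : ℤ) :
    dif R (DirectSum.decompose (gr R) a n) = 0 := by
  rw [map_decompose (gr R) (gr R) (dif R) 1 DGRing.d_mem, ha]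
  simp

theorem mdif_decompose_eq_zero {m : M} (hm : mdif R M m = 0) (n : ℤ) :
    mdif R M (DirectSum.decompose (mgr R M) m n) = 0 := by
  rw [map_decompose (mgr R M) (mgr R M) (mdif R M) 1 (DGModule.d_mem (R := R)), hm]
  simp

theorem decompose_smul {j : ℤ} {m : M} (hm : m ∈ mgr R M j) (r : R) (n : ℤ) :
    (DirectSum.decompose (mgr R M) (r • m) (n + j) : M) =
      (DirectSum.decompose (gr R) r n : R) • m :=
  (map_decompose (gr R) (mgr R M) (AddMonoidHom.flip (smulAddHom R M) m) j
    (fun h => DGModule.smul_mem h hm) r n).symm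

/-- The homogeneous components of the elements of a span of homogeneous cycles lie in the span. -/
theorem decompose_mem_span {ι : Type*} {v : ι → mcycles R M} {e : ι → ℤ}
    (hv : ∀ i, (v i : M) ∈ mgr R M (e i)) (s : Set ι) {y : mcycles R M}
    (hy : y ∈ Submodule.span (cycles R) (v '' s)) (n : ℤ) :
    ∃ z ∈ Submodule.span (cycles R) (v '' s), (z : M) = DirectSum.decompose (mgr R M) (y : M) n := by
  rw [Finsupp.mem_span_image_iff_linearCombination] at hy
  obtain ⟨c, hc, rfl⟩ := hy
  -- As `v i` has degree `e i`, the degree `n` part of `∑ c_i v_i` is obtained by cutting `c_i` down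
  -- to degree `n - e i`; the coefficient stays a cycle.
  refine ⟨∑ i ∈ c.support,
    (⟨DirectSum.decompose (gr R) (c i : R) (n - e i), dif_decompose_eq_zero (c i).2 _⟩ :
      cycles R) • v i, ?_, ?_⟩
  · refine Submodule.sum_mem _ fun i hi => Submodule.smul_mem _ _ (Submodule.subset_span ?_)
    exact ⟨i, hc hi, rfl⟩
  · rw [Finsupp.linearCombination_apply, Finsupp.sum, Submodule.coe_sum, Submodule.coe_sum,
      DirectSum.decompose_sum, DFinsupp.finsetSum_apply, AddSubmonoidClass.coe_finsetSum]
    refine Finset.sum_congr rfl fun i _ => ?_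
    have := decompose_smul (hv i) (c i : R) (n - e i)
    rw [sub_add_cancel] at this
    exact this.symm

/-- The cycles of a dg-module over a dg-division ring have a homogeneous basis. -/
theorem exists_homogeneous_basis_mcycles (hR : IsDGDivision R) (M : Type v) [AddCommGroup M]
    [Module R M] [DGModule R M] :
    ∃ (I : Type v) (e : I → ℤ) (b : Module.Basis I (cycles R) (mcycles R M)),
      ∀ i, (b i : M) ∈ mgr R M (e i) := by
  classical
  let ι := {m : mcycles R M // ∃ n, (m : M) ∈ mgr R M n}
  let v : ι → mcycles R M := Subtype.val
  choose e hv using fun i : ι => i.2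
  -- The family consists of all homogeneous cycles; over a general ring, maximality only puts some
  -- nonzero multiple of each remaining cycle into the span.
  obtain ⟨s, hs, hmax⟩ := exists_maximal_linearIndepOn (cycles R) v
  have hom : ∀ i : ι, v i ∈ Submodule.span (cycles R) (v '' s) := by
    intro i
    by_cases his : i ∈ s
    · exact Submodule.subset_span ⟨i, his, rfl⟩
    obtain ⟨a, ha, hmem⟩ := hmax i his
    -- The coefficient `a` need not be homogeneous, but one of its components is nonzero and hence
    -- has a left inverse `w` among the cycles. Taking the component of degree `n + e i` of `a • v
    -- i` keeps it in the span and leaves `a_n • v i`, which `w` turns into `v i`.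
    obtain ⟨n, hn⟩ : ∃ n, (DirectSum.decompose (gr R) (a : R) n : R) ≠ 0 := by
      by_contra! h
      exact ha (Subtype.ext (eq_of_decompose_eq (gr R) fun n => by rw [h n]; simp))
    obtain ⟨w, hdw, hw⟩ := hR.exists_cycle_mul_eq_one (SetLike.coe_mem _)
      (dif_decompose_eq_zero a.2 n) hn
    obtain ⟨z, hz, hz'⟩ := decompose_mem_span hv s hmem (n + e i)
    have h : v i = (⟨w, hdw⟩ : cycles R) • z := by
      apply Subtype.ext
      change (v i : M) = w • (z : M)
      rw [hz', show ((a • v i : mcycles R M) : M) = (a : R) • (v i : M) from rfl,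
        decompose_smul (hv i), smul_smul, hw, one_smul]
    exact h ▸ Submodule.smul_mem _ _ hz
  refine ⟨s, fun i => e i, Module.Basis.mk hs.linearIndependent ?_, fun i => ?_⟩
  · intro m _
    rw [← Set.image_eq_range]
    -- The components of a cycle are homogeneous cycles, so these span all cycles.
    have hm : m = ∑ n ∈ (DirectSum.decompose (mgr R M) (m : M)).support,
        (⟨DirectSum.decompose (mgr R M) (m : M) n, mdif_decompose_eq_zero m.2 n⟩ :
          mcycles R M) := by
      apply Subtype.ext
      rw [Submodule.coe_sum]
      exact (DirectSum.sum_support_decompose (mgr R M) (m : M)).symm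
    rw [hm]
    exact Submodule.sum_mem _ fun n _ => hom ⟨_, n, SetLike.coe_mem _⟩
  · rw [Module.Basis.mk_apply]
    exact hv i

end Ring


/-! ### Free dg-modules on cycles, and freeness when `1` is a boundary. -/

section Free

variable {R : Type u} [Ring R] [DGRing R] {M : Type v} [AddCommGroup M] [Module R M] [DGModule R M]
  {I : Type w} {e : I → ℤ}

/-- The linear map from a free dg-module that sends the generators to given elements. -/
noncomputable def freeLinear (e : I → ℤ) (b : I → M) : Free R e →ₗ[R] M :=
  (Finsupp.linearCombination R b : (I →₀ R) →ₗ[R] M)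

theorem freeLinear_fsingle (b : I → M) (i : I) (r : R) :
    freeLinear e b (fsingle R e i r) = r • b i :=
  Finsupp.linearCombination_single R r i

/-- The morphism from a free dg-module that sends the generators to given homogeneous cycles. -/
noncomputable def freeDesc (b : I → M) (hb : ∀ i, b i ∈ mgr R M (e i)) (hdb : ∀ i, mdif R M (b i) = 0) :
    DGModuleHom R (Free R e) M where
  toLinearMap := freeLinear e b
  map_deg {n x} hx := by
    refine sum_mem fun i _ => ?_
    have := DGModule.smul_mem (hx i) (hb i)
    rwa [sub_add_cancel] at this
  map_d x := by
    induction x using free_induction with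
    | h0 => simp only [map_zero]
    | hadd x y hx hy => simp only [map_add, hx, hy]
    | hh i n r hr =>
      have hd : mdif R (Free R e) (fsingle R e i r) = fsingle R e i (dif R r) :=
        Finsupp.mapRange_single (hf := map_zero (dif R))
      rw [hd, freeLinear_fsingle, freeLinear_fsingle, mdif_smul, hdb, smul_zero, add_zero]

theorem freeDesc_fsingle (b : I → M) (hb : ∀ i, b i ∈ mgr R M (e i))
    (hdb : ∀ i, mdif R M (b i) = 0) (i : I) (r : R) :
    (freeDesc b hb hdb).toLinearMap (fsingle R e i r) = r • b i :=
  freeLinear_fsingle b i r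

/-- The inverse of a bijective morphism of dg-modules. -/
noncomputable def DGModuleHom.symm {N : Type w} [AddCommGroup N] [Module R N] [DGModule R N]
    (f : DGModuleHom R M N) (hf : Function.Bijective f.toLinearMap) : DGModuleHom R N M where
  toLinearMap := (LinearEquiv.ofBijective f.toLinearMap hf).symm.toLinearMap
  map_deg {i n} hn := by
    refine mem_of_map_mem (mgr R M) (mgr R N) f.toLinearMap.toAddMonoidHom f.map_deg hf.1 ?_
    exact ((LinearEquiv.ofBijective f.toLinearMap hf).apply_symm_apply n).symm ▸ hn
  map_d n := by
    apply hf.1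
    rw [f.map_d]
    let g := LinearEquiv.ofBijective f.toLinearMap hf
    exact (g.apply_symm_apply _).trans (congrArg (mdif R N) (g.apply_symm_apply n)).symm

theorem DGModuleHom.apply_symm {N : Type w} [AddCommGroup N] [Module R N] [DGModule R N]
    (f : DGModuleHom R M N) (hf : Function.Bijective f.toLinearMap) (n : N) :
    f.toLinearMap ((f.symm hf).toLinearMap n) = n :=
  (LinearEquiv.ofBijective f.toLinearMap hf).apply_symm_apply n

/-- If `1` is a boundary, then a dg-module is free on every homogeneous basis of its cycles. -/
theorem freeDesc_bijective {x : R} (hx : x ∈ gr R (-1)) (hdx : dif R x = 1)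
    (b : Module.Basis I (cycles R) (mcycles R M)) (hb : ∀ i, (b i : M) ∈ mgr R M (e i)) :
    Function.Bijective (freeDesc (fun i => (b i : M)) hb fun i => (b i).2).toLinearMap := by
  set f := freeDesc (fun i => (b i : M)) hb fun i => (b i).2
  -- the restriction of `f` to the elements with coefficients in the ring of cycles
  have hf : ∀ c : I →₀ cycles R, f.toLinearMap (Finsupp.mapRange Subtype.val rfl c : I →₀ R) =
      (Finsupp.linearCombination (cycles R) b c : mcycles R M) := by
    intro c
    refine (Finsupp.sum_mapRange_index fun i => zero_smul R (b i : M)).trans ?_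
    rw [Finsupp.linearCombination_apply, Finsupp.sum, Finsupp.sum, Submodule.coe_sum]
    rfl
  -- The generators are cycles, so a cycle of the free module has all its coefficients in the ring
  -- of cycles, where linear independence of `b` applies.
  have hcycle : ∀ y : Free R e, mdif R (Free R e) y = 0 → f.toLinearMap y = 0 → y = 0 := by
    intro y hy hfy
    let c : I →₀ cycles R := Finsupp.onFinset (Finsupp.support (α := I) (M := R) y)
      (fun i => ⟨coeff R e i y, congrArg (coeff R e i) hy⟩) fun i hi =>
        Finsupp.mem_support_iff.2 fun h => hi (Subtype.ext h)
    have hc : (Finsupp.mapRange Subtype.val rfl c : I →₀ R) = y := Finsupp.ext fun i => rfl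
    have h := hf c
    rw [hc, hfy] at h
    have hc0 : c = 0 := b.linearIndependent (by rw [map_zero]; exact Subtype.ext h.symm)
    rw [← hc, hc0]
    exact Finsupp.mapRange_zero
  have hrange : ∀ m : M, mdif R M m = 0 → ∃ y, f.toLinearMap y = m := by
    intro m hm
    refine ⟨(Finsupp.mapRange Subtype.val rfl (b.repr ⟨m, hm⟩) : I →₀ R), (hf _).trans ?_⟩
    rw [b.linearCombination_repr]
  constructor
  · rw [injective_iff_map_eq_zero]
    intro y hy
    -- The kernel is stable under the differential: `d y` is a cycle in the kernel, hence zero, and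
    -- therefore `y` is itself a cycle in the kernel.
    have h1 : mdif R (Free R e) y = 0 :=
      hcycle _ (DGModule.d_d (R := R) y) (by rw [f.map_d, hy, map_zero])
    exact hcycle y h1 hy
  · intro m
    -- By the homotopy identity, `m = d(x m) + x d(m)`; both `d(x m)` and `d(m)` are cycles, thus in
    -- the image.
    obtain ⟨y, hy⟩ := hrange (mdif R M m) (DGModule.d_d (R := R) m)
    obtain ⟨z, hz⟩ := hrange (mdif R M (x • m)) (DGModule.d_d (R := R) _)
    refine ⟨z + x • y, ?_⟩
    rw [map_add, map_smul, hy, hz, mdif_smul_of_mem hx hdx, sub_add_cancel]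

end Free

/-! ### Change of rings for free dg-modules. -/

section BaseChange

variable {R : Type u} [Ring R] [DGRing R] {S : Type v} [Ring S] [DGRing S] (f : DGHom R S)
  {I : Type w} (e : I → ℤ)

/-- The map of free dg-modules induced by a homomorphism of dg-rings. -/
noncomputable def freeMap : DGModuleHom R (Free R e) (Restrict f (Free S e)) where
  toFun := Finsupp.mapRange.addMonoidHom f.toRingHom.toAddMonoidHom
  map_add' := map_add _
  map_smul' r x := Finsupp.ext fun i => map_mul f.toRingHom r (coeff R e i x)
  map_deg hx i := f.map_deg (hx i)
  map_d x := Finsupp.ext fun i => f.map_d (coeff R e i x)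

theorem freeMap_fsingle (i : I) (r : R) :
    (freeMap f e).toLinearMap (fsingle R e i r) = fsingle S e i (f r) :=
  Finsupp.mapRange_single (hf := map_zero f.toRingHom)

end BaseChange


/-! ### Averaging an `L`-linear section with the separability element. -/

section Averaging

variable {K : Type u} {A : Type v} {L : Type w} [Ring K] [DGRing K] [Ring A] [DGRing A]
  [Ring L] [DGRing L] (φ : DGHom K A) (ψ : DGHom K L) [φ.IsGradedCentral] [ψ.IsGradedCentral]

/-- The morphism of dg-rings `A → A ⊗_K L`, `a ↦ a ⊗ 1`. -/
noncomputable def inclLeft : DGHom A (Tensor φ ψ) where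
  toFun a := tmul φ ψ a 1
  map_one' := rfl
  map_zero' := zero_tmul φ ψ 1
  map_add' a a' := add_tmul φ ψ a a' 1
  map_mul' a a' := by
    induction a' using induction_gr with
    | h0 => simp only [mul_zero, zero_tmul]
    | hadd x y hx hy => simp only [mul_add, add_tmul, hx, hy]
    | hh i a' ha' =>
      rw [tmul_mul_tmul φ ψ (one_mem_gr (A := L)) ha', zero_mul, sgn_zero, one_smul, one_mul]
  map_deg {i a} ha := by
    have := tmul_mem φ ψ ha (one_mem_gr (A := L))
    rwa [add_zero] at this
  map_d a := by
    change tmul φ ψ (dif A a) 1 = td φ ψ (tmul φ ψ a 1)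
    rw [td_tmul, d_one, tmul_zero, add_zero]

/-- Because of this, an `L`-linear map commutes with the action of `φ(K)`, which is what makes
`average` well defined on `A ⊗_K A`. -/
theorem inclLeft_comp_eq (k : K) : inclLeft φ ψ (φ k) = inclRight φ ψ (ψ k) := by
  have := tmul_balance φ ψ 1 k 1
  rwa [one_mul, mul_one] at this

theorem inclLeft_mul_inclRight {i j : ℤ} {a : A} {l : L} (ha : a ∈ gr A i) (hl : l ∈ gr L j) :
    inclLeft φ ψ a * inclRight φ ψ l = sgn (j * i) • (inclRight φ ψ l * inclLeft φ ψ a) := by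
  change tmul φ ψ a 1 * tmul φ ψ 1 l = sgn (j * i) • (tmul φ ψ 1 l * tmul φ ψ a 1)
  rw [tmul_mul_tmul φ ψ (one_mem_gr (A := L)) (one_mem_gr (A := A)), tmul_mul_tmul φ ψ hl ha,
    smul_smul, sgn_sq, zero_mul, sgn_zero, mul_one, one_mul, one_mul, mul_one]

theorem tmul_eq_inclLeft_mul_inclRight (a : A) (l : L) :
    tmul φ ψ a l = inclLeft φ ψ a * inclRight φ ψ l := by
  change _ = tmul φ ψ a 1 * tmul φ ψ 1 l
  rw [tmul_mul_tmul φ ψ (one_mem_gr (A := L)) (one_mem_gr (A := A)), zero_mul, sgn_zero, one_smul,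
    mul_one, one_mul]

variable {M : Type x} [AddCommGroup M] [Module (Tensor φ ψ) M] [DGModule (Tensor φ ψ) M]
  {P : Type y} [AddCommGroup P] [Module (Tensor φ ψ) P] [DGModule (Tensor φ ψ) P]

variable {φ ψ} in
/-- An `L`-linear morphism of dg-modules over `A ⊗_K L`, as an additive map. -/
noncomputable def restrictHom (σ : DGModuleHom L (Restrict (inclRight φ ψ) M) (Restrict (inclRight φ ψ) P)) :
    M →+ P := σ.toLinearMap.toAddMonoidHom

variable {φ ψ}
variable (σ : DGModuleHom L (Restrict (inclRight φ ψ) M) (Restrict (inclRight φ ψ) P))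

theorem restrictHom_smul (l : L) (m : M) :
    restrictHom σ (inclRight φ ψ l • m) = inclRight φ ψ l • restrictHom σ m :=
  σ.toLinearMap.map_smul l m

theorem restrictHom_mem {n : ℤ} {m : M} (hm : m ∈ mgr (Tensor φ ψ) M n) :
    restrictHom σ m ∈ mgr (Tensor φ ψ) P n := σ.map_deg hm

theorem restrictHom_d (m : M) :
    restrictHom σ (mdif (Tensor φ ψ) M m) = mdif (Tensor φ ψ) P (restrictHom σ m) := σ.map_d m

/-- The map `m ↦ a σ(a' m)`, as a biadditive function of `a` and `a'`. -/
noncomputable def conjugate : A →+ A →+ M →+ P :=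
  AddMonoidHom.mk' (fun a => AddMonoidHom.mk' (fun a' =>
      (smulAddHom (Tensor φ ψ) P (inclLeft φ ψ a)).comp
        ((restrictHom σ).comp (smulAddHom (Tensor φ ψ) M (inclLeft φ ψ a'))))
      (fun a' b' => by ext m; simp))
    (fun a b => by ext a' m; simp)

/-- The map `m ↦ a σ(a' m)` attached to `a ⊗ a'`. -/
noncomputable def average : Tensor φ φ →+ M →+ P :=
  tlift φ φ (TensorProduct.liftAddHom (conjugate σ) fun n a a' => by
    rw [map_zsmul, map_zsmul, AddMonoidHom.smul_apply]) <| by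
    intro a k a'
    ext m
    -- Balancing over `K`: `φ k` acts on `M` and `P` as `ψ k` does, so it passes through the
    -- `L`-linear map.
    change inclLeft φ ψ (a * φ k) • restrictHom σ (inclLeft φ ψ a' • m) =
      inclLeft φ ψ a • restrictHom σ (inclLeft φ ψ (φ k * a') • m)
    rw [map_mul, map_mul, inclLeft_comp_eq, mul_smul, mul_smul, restrictHom_smul]

theorem average_tmul (a a' : A) (m : M) :
    average σ (tmul φ φ a a') m = inclLeft φ ψ a • restrictHom σ (inclLeft φ ψ a' • m) := rfl

theorem average_lact (a : A) (t : Tensor φ φ) (m : M) :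
    average σ (lact φ φ a t) m = inclLeft φ ψ a • average σ t m := by
  induction t using tensor_induction with
  | h0 => simp
  | hadd s t hs ht => simp only [map_add, AddMonoidHom.add_apply, smul_add, hs, ht]
  | hh i j b _ c _ =>
    change average σ (tmul φ φ (a * b) c) m = _
    rw [average_tmul, average_tmul, map_mul, mul_smul]

theorem average_ract (a : A) (t : Tensor φ φ) (m : M) :
    average σ (ract φ φ a t) m = average σ t (inclLeft φ ψ a • m) := by
  induction t using tensor_induction with
  | h0 => simp
  | hadd s t hs ht => simp only [map_add, AddMonoidHom.add_apply, hs, ht]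
  | hh i j b _ c _ =>
    change average σ (tmul φ φ b (c * a)) m = _
    rw [average_tmul, average_tmul, map_mul, mul_smul]

/-- Moving `l` past `a'` and then past `a` costs the signs `(-1)^{|l||a'|}` and `(-1)^{|l||a|}`,
whose product depends only on the total degree of the tensor. For the degree `0` element `ρ 1` no
sign remains. -/
theorem average_inclRight_smul {n j : ℤ} {t : Tensor φ φ} (ht : t ∈ tdeg φ φ n) {l : L}
    (hl : l ∈ gr L j) (m : M) :
    average σ t (inclRight φ ψ l • m) = sgn (j * n) • inclRight φ ψ l • average σ t m := by
  induction t, ht using tdeg_induction with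
  | h0 => simp
  | hadd s t _ _ hs ht => simp only [map_add, AddMonoidHom.add_apply, smul_add, hs, ht]
  | hh i i' h a ha a' ha' =>
    subst h
    rw [average_tmul, average_tmul, ← mul_smul, inclLeft_mul_inclRight φ ψ ha' hl, smul_assoc,
      map_zsmul, mul_smul, restrictHom_smul, smul_comm, ← mul_smul,
      inclLeft_mul_inclRight φ ψ ha hl, smul_assoc, mul_smul, smul_smul, mul_add, sgn_add, mul_comm]

theorem average_mem {n j : ℤ} {t : Tensor φ φ} (ht : t ∈ tdeg φ φ n) {m : M}
    (hm : m ∈ mgr (Tensor φ ψ) M j) : average σ t m ∈ mgr (Tensor φ ψ) P (n + j) := by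
  induction t, ht using tdeg_induction with
  | h0 => rw [map_zero, AddMonoidHom.zero_apply]; exact zero_mem _
  | hadd s t _ _ hs ht => rw [map_add, AddMonoidHom.add_apply]; exact add_mem hs ht
  | hh i i' h a ha a' ha' =>
    rw [average_tmul, ← h, add_assoc]
    exact DGModule.smul_mem ((inclLeft φ ψ).map_deg ha) (restrictHom_mem σ
      (DGModule.smul_mem ((inclLeft φ ψ).map_deg ha') hm))

/-- This is the Leibniz rule for `a σ(a' m)`; `σ` contributes no term of its own since it commutes
with the differentials. Averages over cycles of degree `0` therefore commute with them too. -/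
theorem mdif_average {n : ℤ} {t : Tensor φ φ} (ht : t ∈ tdeg φ φ n) (m : M) :
    mdif (Tensor φ ψ) P (average σ t m) =
      average σ (td φ φ t) m + sgn n • average σ t (mdif (Tensor φ ψ) M m) := by
  induction t, ht using tdeg_induction with
  | h0 => simp
  | hadd s t _ _ hs ht => simp only [map_add, AddMonoidHom.add_apply, smul_add, hs, ht]; abel
  | hh i i' h a ha a' ha' =>
    subst h
    rw [td_tmul, map_add, AddMonoidHom.add_apply]
    simp only [average_tmul]
    rw [mdif_smul, ← restrictHom_d, mdif_smul, ← map_signInv, ← map_signInv,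
      ← DGHom.map_d, ← DGHom.map_d, signInv_of_mem ha, signInv_of_mem ha', map_add, smul_add]
    simp only [map_zsmul, smul_assoc, sgn_add]
    rw [smul_comm (inclLeft φ ψ a) (sgn i'), ← mul_smul (sgn i) (sgn i')]
    abel

/-- An `A ⊗_K L`-linear retraction of an `L`-linear morphism is inherited by its averages, up to
the image of the multiplication map. -/
theorem map_average (π : DGModuleHom (Tensor φ ψ) P M)
    (hσ : ∀ m, π.toLinearMap (restrictHom σ m) = m) (t : Tensor φ φ) (m : M) :
    π.toLinearMap (average σ t m) = inclLeft φ ψ (multMap φ t) • m := by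
  induction t using tensor_induction with
  | h0 => simp
  | hadd s t hs ht => simp only [map_add, AddMonoidHom.add_apply, add_smul, hs, ht]
  | hh i j a _ a' _ =>
    rw [average_tmul, map_smul, hσ, multMap_tmul, map_mul, mul_smul]

/-- If `K → A` is dg-separable, then a morphism of dg-modules over `A ⊗_K L` that splits over `L`
splits. -/
theorem DGHom.IsDGSeparable.isDirectSummand (hφ : φ.IsDGSeparable)
    (π : DGModuleHom (Tensor φ ψ) P M) (hσ : ∀ m, π.toLinearMap (restrictHom σ m) = m) :
    IsDirectSummand (Tensor φ ψ) M P := by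
  obtain ⟨ρ, hdeg, hd, hbi, hmul⟩ := hφ
  have h1 : ρ 1 ∈ tdeg φ φ 0 := hdeg 0 1 one_mem_gr
  -- Bimodule linearity of `ρ` gives `ρ(1) a = ρ(a) = a ρ(1)`, so `a` can be moved from inside the
  -- average to the outside.
  have hA : ∀ (a : A) (m : M),
      average σ (ρ 1) (inclLeft φ ψ a • m) = inclLeft φ ψ a • average σ (ρ 1) m := by
    intro a m
    have hr := hbi 1 1 a
    have hl := hbi a 1 1
    have hone : ∀ t : Tensor φ φ, lact φ φ 1 t = t ∧ ract φ φ 1 t = t := by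
      intro t
      induction t using tensor_induction with
      | h0 => simp
      | hadd s t hs ht => simp only [map_add, hs, ht, and_self]
      | hh i j b _ c _ =>
        exact ⟨congrArg (tmul φ φ · c) (one_mul b), congrArg (tmul φ φ b) (mul_one c)⟩
    rw [(hone _).1, one_mul, one_mul] at hr
    rw [(hone _).2, mul_one, mul_one] at hl
    rw [← average_ract, ← hr, hl, average_lact]
  have hL : ∀ (l : L) (m : M),
      average σ (ρ 1) (inclRight φ ψ l • m) = inclRight φ ψ l • average σ (ρ 1) m := by
    intro l m
    induction l using induction_gr with
    | h0 => simp
    | hadd l l' hl hl' => simp only [map_add, add_smul, hl, hl']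
    | hh j l hl => rw [average_inclRight_smul σ h1 hl, mul_zero, sgn_zero, one_smul]
  refine ⟨⟨⟨(average σ (ρ 1)).toAddHom, fun r m => ?_⟩, fun {j m} hm => ?_, fun m => ?_⟩, π,
    fun m => ?_⟩
  · change average σ (ρ 1) (r • m) = r • average σ (ρ 1) m
    induction r using tensor_induction with
    | h0 => simp
    | hadd s t hs ht => simp only [map_add, add_smul, hs, ht]
    | hh i j a _ l _ =>
      rw [tmul_eq_inclLeft_mul_inclRight, mul_smul, mul_smul, hA, hL]
  · have := average_mem σ h1 hm
    rwa [zero_add] at this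
  -- The element `ρ 1` is a cycle, since its differential is `ρ (d 1) = 0`.
  · have h := mdif_average σ h1 m
    rw [← hd, d_one, map_zero, map_zero, AddMonoidHom.zero_apply, zero_add, sgn_zero, one_smul] at h
    exact h.symm
  · change π.toLinearMap (average σ (ρ 1) m) = m
    rw [map_average σ π hσ, hmul, map_one, one_smul]

/-- A dg-module over `A ⊗_K L`, where `K → A` is dg-separable and `1` is a boundary in `L`, is a
direct summand of the free dg-module on every homogeneous basis of its cycles over the cycles of
`L`. -/
theorem DGHom.IsDGSeparable.isDirectSummand_free (hφ : φ.IsDGSeparable) {x : L}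
    (hx : x ∈ gr L (-1)) (hdx : dif L x = 1) {I : Type*} {e : I → ℤ}
    (b : Module.Basis I (cycles L) (mcycles L (Restrict (inclRight φ ψ) M)))
    (hb : ∀ i, (b i : Restrict (inclRight φ ψ) M) ∈ mgr L (Restrict (inclRight φ ψ) M) (e i)) :
    IsDirectSummand (Tensor φ ψ) M (Free (Tensor φ ψ) e) := by
  have hbij := freeDesc_bijective hx hdx b hb
  set f := freeDesc (fun i => (b i : Restrict (inclRight φ ψ) M)) hb fun i => (b i).2
  -- Restriction to `L` changes neither the grading nor the differential, so the same elements are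
  -- homogeneous cycles over `A ⊗_K L` and define a morphism there.
  let π : DGModuleHom (Tensor φ ψ) (Free (Tensor φ ψ) e) M :=
    freeDesc (M := M) (fun i => (b i : Restrict (inclRight φ ψ) M)) hb fun i => (b i).2
  let g := freeMap (inclRight φ ψ) e
  -- On the copy of the free `L`-module inside the free module over `A ⊗_K L`, `π` is the
  -- isomorphism `f`; hence `g` after the inverse of `f` is a section of `π` over `L`.
  have hπ : ∀ y : Free L e, π.toLinearMap (g.toLinearMap y) = f.toLinearMap y := by
    intro y
    induction y using free_induction with
    | h0 => rw [map_zero, map_zero]; exact map_zero _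
    | hadd y z hy hz =>
      rw [map_add, map_add, ← hy, ← hz]
      exact map_add π.toLinearMap _ _
    | hh i n l _ =>
      exact (congrArg π.toLinearMap (freeMap_fsingle (inclRight φ ψ) e i l)).trans
        ((freeLinear_fsingle (M := M) _ i _).trans (freeDesc_fsingle _ hb _ i l).symm)
  let σ : DGModuleHom L (Restrict (inclRight φ ψ) M)
      (Restrict (inclRight φ ψ) (Free (Tensor φ ψ) e)) :=
    { toLinearMap := g.toLinearMap ∘ₗ (f.symm hbij).toLinearMap
      map_deg := fun hm => g.map_deg ((f.symm hbij).map_deg hm)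
      map_d := fun m => (congrArg g.toLinearMap ((f.symm hbij).map_d m)).trans (g.map_d _) }
  exact hφ.isDirectSummand σ π fun m => (hπ _).trans (f.apply_symm hbij m)

end Averaging

end DG

/-! ### The main theorem. -/

theorem theorem4p3
    {K : Type u} [Ring K] [DG.DGRing K] [DG.IsGradedCommutative K]
    (hK : DG.IsDGDivision K) (hKac : DG.IsAcyclic K)
    {A : Type v} [Ring A] [DG.DGRing A] (φ : DG.DGHom K A) [φ.IsGradedCentral]
    (hφ : φ.IsDGSeparable)
    {L : Type w} [Ring L] [DG.DGRing L] [DG.IsGradedCommutative L]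
    (hL : DG.IsDGDivision L) (ψ : DG.DGHom K L)
    (M : Type x) [AddCommGroup M] [Module (DG.Tensor φ ψ) M] [DG.DGModule (DG.Tensor φ ψ) M] :
    (∃ (I : Type x) (e : I → ℤ),
      DG.IsDirectSummand (DG.Tensor φ ψ) M (DG.Free (DG.Tensor φ ψ) e)) ∧
    (DG.IsAcyclic L →
      (∃ (I : Type x) (e : I → ℤ) (b : Module.Basis I (DG.cycles L)
          (DG.mcycles L (DG.Restrict (DG.inclRight φ ψ) M))),
        ∀ i, (b i : DG.Restrict (DG.inclRight φ ψ) M) ∈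
          DG.mgr L (DG.Restrict (DG.inclRight φ ψ) M) (e i)) ∧
      ∀ (I : Type y) (e : I → ℤ) (b : Module.Basis I (DG.cycles L)
          (DG.mcycles L (DG.Restrict (DG.inclRight φ ψ) M))),
        (∀ i, (b i : DG.Restrict (DG.inclRight φ ψ) M) ∈
          DG.mgr L (DG.Restrict (DG.inclRight φ ψ) M) (e i)) →
        DG.IsDirectSummand (DG.Tensor φ ψ) M (DG.Free (DG.Tensor φ ψ) e)) ∧
    ((∀ l : L, DG.dif L l = 0) →
      (∃ (I : Type x) (e : I → ℤ) (b : Module.Basis I L (DG.Restrict (DG.inclRight φ ψ) M)),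
        ∀ i, b i ∈ DG.mgr L (DG.Restrict (DG.inclRight φ ψ) M) (e i)) ∧
      ∀ (I : Type y) (e : I → ℤ) (b : Module.Basis I L (DG.Restrict (DG.inclRight φ ψ) M)),
        (∀ i, b i ∈ DG.mgr L (DG.Restrict (DG.inclRight φ ψ) M) (e i)) →
        DG.IsDirectSummand (DG.Tensor φ ψ) M (DG.Free (DG.Tensor φ ψ) e)) := by
  obtain ⟨x, hx, hdx⟩ := ψ.exists_d_eq_one hKac
  have hbasis := DG.exists_homogeneous_basis_mcycles hL (DG.Restrict (DG.inclRight φ ψ) M)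
  refine ⟨?_, fun _ => ⟨hbasis, fun I e b hb => hφ.isDirectSummand_free hx hdx b hb⟩, fun hd => ?_⟩
  · obtain ⟨I, e, b, hb⟩ := hbasis
    exact ⟨I, e, hφ.isDirectSummand_free hx hdx b hb⟩
  -- With zero differential, `1 = d x` collapses `L` to the zero ring, and with it `M`.
  · have hL0 : (1 : L) = 0 := hdx.symm.trans (hd x)
    have : Subsingleton L := subsingleton_of_zero_eq_one hL0.symm
    have : Subsingleton (DG.Restrict (DG.inclRight φ ψ) M) := Module.subsingleton L _
    have hM : ∀ m : M, m = 0 := fun m =>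
      Subsingleton.elim (α := DG.Restrict (DG.inclRight φ ψ) M) m 0
    refine ⟨⟨PEmpty, PEmpty.elim, Module.Basis.empty _, fun i => i.elim⟩, fun I e b hb => ?_⟩
    -- Over the zero ring any index set carries a basis of the zero module, so `I` is arbitrary
    -- here; `M = 0` is a summand of anything through zero maps.
    refine ⟨⟨0, fun _ => zero_mem _, fun m => ?_⟩, ⟨0, fun _ => zero_mem _, fun m => ?_⟩, fun m => ?_⟩
    · exact (map_zero _).symm
    · exact (map_zero _).symm
    · exact (hM m).symm
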